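/- Let $\Omega\in\mathbb{R}^{p\times d}$ be a nonzero matrix (the analysis operator), let $x\in\mathbb{R}^d$, and let $\Lambda=\{j\in\{1,\dots,p\}:(\Omega x)_j=0\}$ be the cosupport of $x$. Let $\Omega_\Lambda$ denote the submatrix of $\Omega$ consisting of the rows indexed by $\Lambda$, and let $g$ be a standard Gaussian random vector in $\mathbb{R}^d$. Let $M\in\mathbb{R}^{m\times d}$ be a Gaussian random matrix, i.e. its entries are independent standard normal random variables. Let $0<\varepsilon<1$, $\tau>0$ and $\eta\in\mathbb{R}$. If $$\frac{m^2}{m+1}\;\geq\;\left(\sqrt{d-\frac{\left(\mathbb{E}\|\Omega_\Lambda g\|_1\right)^2}{\max_{\|z\|_2\leq 1}\|\Omega z\|_1^2}}+\sqrt{2\ln(\varepsilon^{-1})}+\tau\right)^2,$$ then there is an event of probability at least $1-\varepsilon$ on which the following holds: for every noise vector $w\in\mathbb{R}^m$ with $\|w\|_2\leq\eta$, with $y=Mx+w$, every minimizer $\hat x$ of $$\min_{z\in\mathbb{R}^d}\|\Omega z\|_1\quad\text{subject to}\quad\|Mz-y\|_2\leq\eta$$ satisfies $$\|x-\hat x\|_2\leq\frac{2\eta}{\tau}.$$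 -/

import Mathlib

open MeasureTheory ProbabilityTheory Matrix

/-- The `ℓ₁`-norm of a real vector with a finite index set. -/
noncomputable def l1Norm {ι : Type*} [Fintype ι] (v : ι → ℝ) : ℝ :=
  ‖WithLp.toLp 1 v‖

theorem l1Norm_eq_sum {ι : Type*} [Fintype ι] (v : ι → ℝ) : l1Norm v = ∑ i, |v i| := by
  simp [l1Norm, PiLp.norm_eq_of_L1]

/-- The cosupport of `x` with respect to `Ω`: the indices of the zero entries of `Ω x`. -/
noncomputable def cosupport {p d : ℕ} (Ω : Matrix (Fin p) (Fin d) ℝ)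
    (x : EuclideanSpace ℝ (Fin d)) : Finset (Fin p) :=
  Finset.univ.filter fun i => (Ω *ᵥ x.ofLp) i = 0

/-- The submatrix `Ω_Λ` of `Ω` formed by the rows indexed by `Λ`. -/
def rowSubmatrix {p d : ℕ} (Ω : Matrix (Fin p) (Fin d) ℝ) (Λ : Finset (Fin p)) :
    Matrix Λ (Fin d) ℝ :=
  Ω.submatrix (fun i => (i : Fin p)) id

/-- The expectation `𝔼 ‖A g‖₁` for a standard Gaussian random vector `g` in `ℝᵈ`. -/
noncomputable def expectedL1 {ι : Type*} [Fintype ι] {d : ℕ} (A : Matrix ι (Fin d) ℝ) : ℝ :=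
  ∫ g, l1Norm (A *ᵥ g.ofLp) ∂(stdGaussian (EuclideanSpace ℝ (Fin d)))

/-- The maximum of `‖Ω z‖₁²` over the Euclidean unit ball `‖z‖₂ ≤ 1`. -/
noncomputable def maxL1Sq {p d : ℕ} (Ω : Matrix (Fin p) (Fin d) ℝ) : ℝ :=
  sSup ((fun z : EuclideanSpace ℝ (Fin d) => l1Norm (Ω *ᵥ z.ofLp) ^ 2) '' {z | ‖z‖ ≤ 1})

/-- The supremum defining `maxL1Sq` is attained. -/
theorem isGreatest_maxL1Sq {p d : ℕ} (Ω : Matrix (Fin p) (Fin d) ℝ) :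
    IsGreatest
      ((fun z : EuclideanSpace ℝ (Fin d) => l1Norm (Ω *ᵥ z.ofLp) ^ 2) '' {z | ‖z‖ ≤ 1})
      (maxL1Sq Ω) := by
  refine IsCompact.isGreatest_sSup (IsCompact.image ?_ ?_) ⟨_, 0, by simp, rfl⟩
  · have h : {z : EuclideanSpace ℝ (Fin d) | ‖z‖ ≤ 1} = Metric.closedBall 0 1 := by
      ext z; simp
    rw [h]
    exact isCompact_closedBall _ _
  · simp only [l1Norm_eq_sum, Matrix.mulVec, dotProduct]
    fun_prop

/-- The integrand in `expectedL1` is integrable, so the expectation is a genuine one. -/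
theorem integrable_l1Norm_mulVec {ι : Type*} [Fintype ι] {d : ℕ} (A : Matrix ι (Fin d) ℝ) :
    Integrable (fun g : EuclideanSpace ℝ (Fin d) => l1Norm (A *ᵥ g.ofLp))
      (stdGaussian (EuclideanSpace ℝ (Fin d))) := by
  simp only [l1Norm_eq_sum, Matrix.mulVec, dotProduct]
  refine integrable_finsetSum _ fun i _ => Integrable.abs ?_
  refine integrable_finsetSum _ fun j _ => Integrable.const_mul ?_ _
  have h : Integrable (fun g : EuclideanSpace ℝ (Fin d) => g)
      (stdGaussian (EuclideanSpace ℝ (Fin d))) := IsGaussian.integrable_id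
  exact (EuclideanSpace.proj (𝕜 := ℝ) j : EuclideanSpace ℝ (Fin d) →L[ℝ] ℝ).integrable_comp h

/-- A random matrix is Gaussian: its entries are independent standard normal variables. -/
structure IsGaussianMatrix {S : Type*} [MeasurableSpace S] (P : Measure S) {m d : ℕ}
    (M : S → Matrix (Fin m) (Fin d) ℝ) : Prop where
  hasLaw_entry : ∀ i j, HasLaw (fun s => M s i j) (gaussianReal 0 1) P
  indep : iIndepFun (fun (ij : Fin m × Fin d) (s : S) => M s ij.1 ij.2) P

/-- The feasible set `{z : ‖M z - y‖₂ ≤ η}` of analysis `ℓ₁`-minimization. -/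
def feasibleSet {m d : ℕ} (M : Matrix (Fin m) (Fin d) ℝ) (y : EuclideanSpace ℝ (Fin m))
    (η : ℝ) : Set (EuclideanSpace ℝ (Fin d)) :=
  {z | ‖WithLp.toLp 2 (M *ᵥ z.ofLp) - y‖ ≤ η}

/-- `xhat` solves: minimize `‖Ω z‖₁` subject to `‖M z - y‖₂ ≤ η`. -/
def IsAnalysisL1Minimizer {p m d : ℕ} (Ω : Matrix (Fin p) (Fin d) ℝ)
    (M : Matrix (Fin m) (Fin d) ℝ) (y : EuclideanSpace ℝ (Fin m)) (η : ℝ)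
    (xhat : EuclideanSpace ℝ (Fin d)) : Prop :=
  xhat ∈ feasibleSet M y η ∧
    IsMinOn (fun z : EuclideanSpace ℝ (Fin d) => l1Norm (Ω *ᵥ z.ofLp)) (feasibleSet M y η) xhat

/-! Convexity reduces recovery to a lower bound for `M` on a cone. Feasibility of both `x` and a
minimizer gives `‖M (x̂ - x)‖ ≤ 2η`, and minimality makes the directional derivative `l1Slope` of
`‖Ω ·‖₁` at `x` nonpositive in the direction `x̂ - x` (`l1Slope_sub_le`). If `‖M z‖ ≥ τ` for every
unit `z` with nonpositive slope, the error is at most `2η/τ`. This condition involves neither the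
noise nor the minimizer, so one event serves all `w`.

The lower bound is Gordon's escape through a mesh. For finitely many unit vectors `p`, the processes
`‖M p‖ + γ` and `‖g‖ - ⟨h, p⟩` are compared through exponential moments, with `γ`, `g`, `h` Gaussian
and independent of each other and of `M` (`gordon_tail_le`). The right side factors into the Laplace
transforms of `‖g‖` and of the support function `S(h) = max ⟨h, p⟩`. Sharp concentration
(`integral_exp_mul_le`) contributes `e^{r²/2}` for each of them, and the scalar `γ` contributes one
`e^{r²/2}` on the left. With `𝔼‖g‖ ≥ m/√(m+1)` and the hypothesis, the failure probability is at
most `e^{-r² + r²/2} = e^{-r²/2}`, which is `ε` for `r = √(2 ln ε⁻¹)`.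

The mean of `S(h)` is bounded by duality (`two_mul_dotProduct_le`, `integral_softmax_le`). A
subgradient `u` has `⟨u, z⟩ ≤ 0` on the cone, so `⟨z, h⟩ ≤ ‖h - t u‖` for `t ≥ 0`. Choosing `u` to
attain the slope in direction `h` and optimizing `t` gives the square root in the hypothesis.

Both Gordon's comparison and the concentration inequality come from one Gaussian interpolation,
`integral_prod_le_of_partialDeriv_le`: along `cos θ • A x + sin θ • B x`, integration by parts
expresses the derivative of the expectation of a product through covariance differences. Norms,
maxima and indicators are replaced by C¹ versions, and the smoothing parameters tend to zero at the
end. -/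

/-! ### Standard Gaussian measure: density, integrability, integration by parts. -/

/-- The law of a family of independent standard normal variables indexed by `ι`. -/
noncomputable abbrev gaussianPi (ι : Type*) [Fintype ι] : Measure (ι → ℝ) :=
  Measure.pi fun _ : ι => gaussianReal 0 1

/-- The density of `gaussianPi ι` with respect to Lebesgue measure. -/
noncomputable def gaussianPiDensity {ι : Type*} [Fintype ι] (x : ι → ℝ) : ℝ :=
  ∏ i, gaussianPDFReal 0 1 (x i)

section GaussianPi

variable {ι : Type*} [Fintype ι]

theorem gaussianPiDensity_nonneg (x : ι → ℝ) : 0 ≤ gaussianPiDensity x :=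
  Finset.prod_nonneg fun _ _ => gaussianPDFReal_nonneg _ _ _

theorem gaussianPiDensity_eq (x : ι → ℝ) :
    gaussianPiDensity x
      = (Real.sqrt (2 * Real.pi))⁻¹ ^ Fintype.card ι * Real.exp (-(x ⬝ᵥ x) / 2) := by
  simp only [gaussianPiDensity, gaussianPDFReal, Finset.prod_mul_distrib, ← Real.exp_sum,
    dotProduct]
  simp [Finset.sum_div, Finset.sum_neg_distrib, neg_div, sq]

theorem continuous_gaussianPiDensity : Continuous (gaussianPiDensity (ι := ι)) := by
  have : (gaussianPiDensity (ι := ι)) = fun x =>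
      (Real.sqrt (2 * Real.pi))⁻¹ ^ Fintype.card ι * Real.exp (-(x ⬝ᵥ x) / 2) :=
    funext gaussianPiDensity_eq
  rw [this]
  simp only [dotProduct]
  fun_prop

theorem gaussianPi_eq_withDensity :
    gaussianPi ι = volume.withDensity fun x => ENNReal.ofReal (gaussianPiDensity x) := by
  refine Measure.pi_eq fun s hs => ?_
  have hint : Integrable (gaussianPiDensity (ι := ι)) volume :=
    Integrable.fintype_prod fun _ => integrable_gaussianPDFReal 0 1
  rw [withDensity_apply _ (MeasurableSet.univ_pi hs),
    ← ofReal_integral_eq_lintegral_ofReal hint.restrict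
      (Filter.Eventually.of_forall gaussianPiDensity_nonneg),
    ← integral_indicator (MeasurableSet.univ_pi hs)]
  have h1 : (Set.univ.pi s).indicator (gaussianPiDensity (ι := ι))
      = fun x => ∏ i, (s i).indicator (gaussianPDFReal 0 1) (x i) := by
    funext x
    by_cases hx : x ∈ Set.univ.pi s
    · rw [Set.indicator_of_mem hx]
      exact Finset.prod_congr rfl fun i _ => (Set.indicator_of_mem (hx i trivial) _).symm
    · rw [Set.indicator_of_notMem hx]
      simp only [Set.mem_pi, Set.mem_univ, true_implies, not_forall] at hx
      obtain ⟨i, hi⟩ := hx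
      exact (Finset.prod_eq_zero (Finset.mem_univ i) (Set.indicator_of_notMem hi _)).symm
  rw [h1, integral_fintype_prod_volume_eq_prod, ENNReal.ofReal_prod_of_nonneg]
  · refine Finset.prod_congr rfl fun i _ => ?_
    rw [integral_indicator (hs i), gaussianReal_apply_eq_integral _ one_ne_zero]
  · exact fun i _ => integral_nonneg fun x =>
      Set.indicator_nonneg (fun y _ => gaussianPDFReal_nonneg _ _ _) _

theorem integral_gaussianPi (f : (ι → ℝ) → ℝ) :
    ∫ x, f x ∂gaussianPi ι = ∫ x, gaussianPiDensity x * f x := by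
  rw [gaussianPi_eq_withDensity, integral_withDensity_eq_integral_toReal_smul
    continuous_gaussianPiDensity.measurable.ennreal_ofReal (by simp)]
  simp [ENNReal.toReal_ofReal (gaussianPiDensity_nonneg _)]

theorem integrable_gaussianPi_iff (f : (ι → ℝ) → ℝ) :
    Integrable f (gaussianPi ι) ↔ Integrable (fun x => gaussianPiDensity x * f x) volume := by
  rw [gaussianPi_eq_withDensity, integrable_withDensity_iff_integrable_smul'
    continuous_gaussianPiDensity.measurable.ennreal_ofReal (by simp)]
  simp [ENNReal.toReal_ofReal (gaussianPiDensity_nonneg _)]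

/-- The sup norm is at most `∑ |x i|`, and `e^{|c||t|} ≤ e^{|c|t} + e^{-|c|t}`, so the function is
dominated by a product of one-dimensional functions with finite Gaussian integral. These bounds
dominate every integrand below. -/
theorem integrable_exp_norm_gaussianPi (c : ℝ) :
    Integrable (fun x : ι → ℝ => Real.exp (c * (1 + ‖x‖))) (gaussianPi ι) := by
  have h1 : Integrable (fun x : ι → ℝ => ∏ i, (Real.exp (|c| * x i) + Real.exp (-|c| * x i)))
      (gaussianPi ι) :=
    Integrable.fintype_prod (f := fun _ : ι => fun t : ℝ =>
      Real.exp (|c| * t) + Real.exp (-|c| * t)) fun _ =>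
      (integrable_exp_mul_gaussianReal _).add (integrable_exp_mul_gaussianReal _)
  refine (h1.const_mul (Real.exp |c|)).mono' (by fun_prop) (Filter.Eventually.of_forall fun x => ?_)
  rw [Real.norm_eq_abs, Real.abs_exp]
  have h2 : ‖x‖ ≤ ∑ i, |x i| :=
    (pi_norm_le_iff_of_nonneg (Finset.sum_nonneg fun i _ => abs_nonneg _)).2 fun i =>
      Finset.single_le_sum (f := fun i => |x i|) (fun i _ => abs_nonneg _) (Finset.mem_univ i)
  calc Real.exp (c * (1 + ‖x‖)) ≤ Real.exp (|c| + ∑ i, |c| * |x i|) := by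
        gcongr
        rw [← Finset.mul_sum, mul_add, mul_one]
        have := abs_nonneg c
        have := le_abs_self c
        have := norm_nonneg x
        gcongr
    _ = Real.exp |c| * ∏ i, Real.exp (|c| * |x i|) := by rw [Real.exp_add, Real.exp_sum]
    _ ≤ _ := by
        gcongr with i
        rcases abs_cases (x i) with ⟨h, _⟩ | ⟨h, _⟩ <;> rw [h]
        · linarith [Real.exp_pos (-|c| * x i)]
        · rw [show |c| * -x i = -|c| * x i by ring]
          linarith [Real.exp_pos (|c| * x i)]

theorem integrable_gaussianPi_of_le_exp {f : (ι → ℝ) → ℝ} (hf : Continuous f) {c : ℝ}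
    (hc : ∀ x, |f x| ≤ Real.exp (c * (1 + ‖x‖))) : Integrable f (gaussianPi ι) :=
  (integrable_exp_norm_gaussianPi c).mono' hf.aestronglyMeasurable
    (Filter.Eventually.of_forall hc)

theorem abs_dotProduct_le_exp (a x : ι → ℝ) :
    |a ⬝ᵥ x| ≤ Real.exp ((∑ i, |a i|) * (1 + ‖x‖)) := by
  have h : |a ⬝ᵥ x| ≤ (∑ i, |a i|) * (1 + ‖x‖) := by
    rw [dotProduct, Finset.sum_mul]
    refine (Finset.abs_sum_le_sum_abs _ _).trans (Finset.sum_le_sum fun i _ => ?_)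
    rw [abs_mul]
    gcongr
    linarith [norm_le_pi_norm x i, Real.norm_eq_abs (x i)]
  linarith [Real.add_one_le_exp ((∑ i, |a i|) * (1 + ‖x‖))]

theorem hasLineDerivAt_gaussianPiDensity (a x : ι → ℝ) :
    HasLineDerivAt ℝ (gaussianPiDensity (ι := ι)) (-(a ⬝ᵥ x) * gaussianPiDensity x) x a := by
  have h1 : HasDerivAt (fun t : ℝ => (x + t • a) ⬝ᵥ (x + t • a)) (2 * (a ⬝ᵥ x)) 0 := by
    have h2 : (fun t : ℝ => (x + t • a) ⬝ᵥ (x + t • a))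
        = fun t : ℝ => x ⬝ᵥ x + (2 * (a ⬝ᵥ x)) * t + (a ⬝ᵥ a) * t ^ 2 := by
      funext t
      simp only [add_dotProduct, dotProduct_add, smul_dotProduct, dotProduct_smul, smul_eq_mul,
        dotProduct_comm x a]
      ring
    rw [h2]
    have h3 := (((hasDerivAt_id (0 : ℝ)).const_mul (2 * (a ⬝ᵥ x))).const_add (x ⬝ᵥ x)).fun_add
      (((hasDerivAt_id (0 : ℝ)).fun_pow 2).const_mul (a ⬝ᵥ a))
    simpa using h3
  have h4 := ((h1.neg.div_const 2).exp).const_mul ((Real.sqrt (2 * Real.pi))⁻¹ ^ Fintype.card ι)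
  unfold HasLineDerivAt
  simp only [gaussianPiDensity_eq]
  convert! h4 using 1
  simp
  ring

/-- Gaussian integration by parts in the direction `a`. -/
theorem integral_dotProduct_mul_gaussianPi (a : ι → ℝ) {G G' : (ι → ℝ) → ℝ}
    (hG : Continuous G) (hG' : Continuous G') (hd : ∀ x, HasLineDerivAt ℝ G (G' x) x a) {c : ℝ}
    (hGc : ∀ x, |G x| ≤ Real.exp (c * (1 + ‖x‖)))
    (hGc' : ∀ x, |G' x| ≤ Real.exp (c * (1 + ‖x‖))) :
    ∫ x, (a ⬝ᵥ x) * G x ∂gaussianPi ι = ∫ x, G' x ∂gaussianPi ι := by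
  have hl : Continuous fun x : ι → ℝ => a ⬝ᵥ x := by simp only [dotProduct]; fun_prop
  have i1 := (integrable_gaussianPi_iff _).1 (integrable_gaussianPi_of_le_exp hG hGc)
  have i2 := (integrable_gaussianPi_iff _).1 (integrable_gaussianPi_of_le_exp hG' hGc')
  have i3 : Integrable (fun x => (a ⬝ᵥ x) * G x) (gaussianPi ι) :=
    integrable_gaussianPi_of_le_exp (hl.mul hG) (c := (∑ i, |a i|) + c) fun x => by
      rw [abs_mul, add_mul, Real.exp_add]
      exact mul_le_mul (abs_dotProduct_le_exp a x) (hGc x) (abs_nonneg _) (Real.exp_pos _).le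
  have i3 := (integrable_gaussianPi_iff _).1 i3
  -- Integration by parts for Lebesgue measure moves the derivative onto the density `ρ`, whose
  -- derivative along `a` is `-⟨a, x⟩ ρ`.
  have key := integral_bilinear_hasLineDerivAt_right_eq_neg_left_of_integrable
    (μ := (volume : Measure (ι → ℝ))) (B := ContinuousLinearMap.mul ℝ ℝ) (v := a)
    (f := G) (f' := G') (g := gaussianPiDensity)
    (g' := fun x => -(a ⬝ᵥ x) * gaussianPiDensity x)
    (by simpa [mul_comm] using i2) (by
      refine i3.neg.congr (Filter.Eventually.of_forall fun x => ?_)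
      simp; ring) (by simpa [mul_comm] using i1) (fun x _ => hd x)
    (fun x _ => hasLineDerivAt_gaussianPiDensity a x)
  rw [integral_gaussianPi, integral_gaussianPi]
  simp only [ContinuousLinearMap.mul_apply'] at key
  have h5 : ∫ x, G x * (-(a ⬝ᵥ x) * gaussianPiDensity x)
      = - ∫ x, gaussianPiDensity x * ((a ⬝ᵥ x) * G x) := by
    rw [← integral_neg]; congr 1; funext x; ring
  rw [h5, neg_inj] at key
  rw [key]
  congr 1; funext x; ring

end GaussianPi

/-! ### Exponential growth, uniform in a parameter. -/

/-- A family of functions with a common bound of exponential growth. -/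
def UniformExpGrowth {Θ E : Type*} [Norm E] (g : Θ → E → ℝ) : Prop :=
  ∃ c, ∀ θ x, |g θ x| ≤ Real.exp (c * (1 + ‖x‖))

namespace UniformExpGrowth

variable {Θ E F : Type*} [SeminormedAddCommGroup E] {g h : Θ → E → ℝ}

theorem mul (hg : UniformExpGrowth g) (hh : UniformExpGrowth h) :
    UniformExpGrowth fun θ x => g θ x * h θ x := by
  obtain ⟨c, hc⟩ := hg
  obtain ⟨c', hc'⟩ := hh
  refine ⟨c + c', fun θ x => ?_⟩
  rw [abs_mul, add_mul, Real.exp_add]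
  exact mul_le_mul (hc θ x) (hc' θ x) (abs_nonneg _) (Real.exp_pos _).le

theorem add (hg : UniformExpGrowth g) (hh : UniformExpGrowth h) :
    UniformExpGrowth fun θ x => g θ x + h θ x := by
  obtain ⟨c, hc⟩ := hg
  obtain ⟨c', hc'⟩ := hh
  refine ⟨1 + (|c| + |c'|), fun θ x => ?_⟩
  have ht := norm_nonneg x
  have h1 : Real.exp (c * (1 + ‖x‖)) ≤ Real.exp ((|c| + |c'|) * (1 + ‖x‖)) := by
    gcongr; linarith [le_abs_self c, abs_nonneg c']
  have h2 : Real.exp (c' * (1 + ‖x‖)) ≤ Real.exp ((|c| + |c'|) * (1 + ‖x‖)) := by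
    gcongr; linarith [le_abs_self c', abs_nonneg c]
  -- The factor 2 from adding two bounds is absorbed by raising the growth constant by 1.
  have h3 : 2 ≤ Real.exp (1 * (1 + ‖x‖)) := by linarith [Real.add_one_le_exp (1 * (1 + ‖x‖))]
  calc |g θ x + h θ x| ≤ |g θ x| + |h θ x| := abs_add_le _ _
    _ ≤ 2 * Real.exp ((|c| + |c'|) * (1 + ‖x‖)) := by linarith [hc θ x, hc' θ x]
    _ ≤ _ := by rw [add_mul 1, Real.exp_add]; gcongr

theorem of_bounded {K : ℝ} (hK : ∀ θ x, |g θ x| ≤ K) : UniformExpGrowth g := by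
  refine ⟨|K|, fun θ x => (hK θ x).trans ?_⟩
  have := Real.add_one_le_exp (|K| * (1 + ‖x‖))
  have := mul_nonneg (abs_nonneg K) (norm_nonneg x)
  linarith [le_abs_self K]

theorem sum {I : Type*} (s : Finset I) {g : I → Θ → E → ℝ}
    (hg : ∀ i ∈ s, UniformExpGrowth (g i)) : UniformExpGrowth fun θ x => ∑ i ∈ s, g i θ x := by
  classical
  induction s using Finset.induction_on with
  | empty => exact of_bounded (K := 0) (by simp)
  | insert i s hi ih =>
    simp only [Finset.sum_insert hi]
    exact (hg i (by simp)).add (ih fun j hj => hg j (by simp [hj]))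

theorem prod {I : Type*} (s : Finset I) {g : I → Θ → E → ℝ}
    (hg : ∀ i ∈ s, UniformExpGrowth (g i)) : UniformExpGrowth fun θ x => ∏ i ∈ s, g i θ x := by
  classical
  induction s using Finset.induction_on with
  | empty => exact of_bounded (K := 1) (by simp)
  | insert i s hi ih =>
    simp only [Finset.prod_insert hi]
    exact (hg i (by simp)).mul (ih fun j hj => hg j (by simp [hj]))

theorem comp [SeminormedAddCommGroup F] {f : F → ℝ} {c : ℝ}
    (hf : ∀ v, |f v| ≤ Real.exp (c * (1 + ‖v‖))) {V : Θ → E → F} {D : ℝ}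
    (hV : ∀ θ x, ‖V θ x‖ ≤ D * (1 + ‖x‖)) : UniformExpGrowth fun θ x => f (V θ x) := by
  refine ⟨|c| * (1 + D), fun θ x => (hf _).trans ?_⟩
  have h1 := norm_nonneg x
  refine Real.exp_le_exp.2 ?_
  calc c * (1 + ‖V θ x‖) ≤ |c| * (1 + D * (1 + ‖x‖)) := by
        calc c * (1 + ‖V θ x‖) ≤ |c| * (1 + ‖V θ x‖) := by gcongr; exact le_abs_self c
          _ ≤ _ := by gcongr; exact hV θ x
    _ ≤ |c| * (1 + D) * (1 + ‖x‖) := by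
        have := mul_nonneg (abs_nonneg c) h1
        nlinarith

end UniformExpGrowth

/-! ### Partial derivatives and the rotation path between two linear images. -/

/-- The `i`-th partial derivative of a function of finitely many real variables. -/
noncomputable def partialDeriv {k : Type*} [Fintype k] [DecidableEq k] (f : (k → ℝ) → ℝ) (i : k)
    (v : k → ℝ) : ℝ :=
  fderiv ℝ f v (Pi.single i 1)

theorem fderiv_apply_eq_sum_partialDeriv {k : Type*} [Fintype k] [DecidableEq k]
    (f : (k → ℝ) → ℝ) (v w : k → ℝ) :
    fderiv ℝ f v w = ∑ i, w i * partialDeriv f i v := by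
  conv_lhs => rw [pi_eq_sum_univ' w, map_sum]
  refine Finset.sum_congr rfl fun i _ => ?_
  rw [map_smul, smul_eq_mul, partialDeriv]

section Rotation

variable {ι k : Type*} [Fintype ι]

/-- The vector `cos θ • A x + sin θ • B x`, where `A` and `B` have the rows `a i` and `b i`. -/
noncomputable def rotated (a b : k → ι → ℝ) (θ : ℝ) (x : ι → ℝ) : k → ℝ :=
  fun i => (Real.cos θ • a i + Real.sin θ • b i) ⬝ᵥ x

@[simp]
theorem rotated_zero (a b : k → ι → ℝ) (x : ι → ℝ) : rotated a b 0 x = fun i => a i ⬝ᵥ x := by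
  funext i
  simp [rotated]

@[simp]
theorem rotated_pi_div_two (a b : k → ι → ℝ) (x : ι → ℝ) :
    rotated a b (Real.pi / 2) x = fun i => b i ⬝ᵥ x := by
  funext i
  simp [rotated]

theorem rotated_add_smul (a b : k → ι → ℝ) (θ : ℝ) (x e : ι → ℝ) (t : ℝ) :
    rotated a b θ (x + t • e) = rotated a b θ x + t • rotated a b θ e := by
  funext i
  simp [rotated, dotProduct_add, dotProduct_smul]

theorem continuous_rotated (a b : k → ι → ℝ) (θ : ℝ) : Continuous (rotated a b θ) := by
  unfold rotated
  simp only [dotProduct]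
  fun_prop

theorem hasDerivAt_rotated (a b : k → ι → ℝ) (x : ι → ℝ) (θ : ℝ) :
    HasDerivAt (fun θ => rotated a b θ x)
      (fun i => (-Real.sin θ • a i + Real.cos θ • b i) ⬝ᵥ x) θ := by
  refine hasDerivAt_pi.2 fun i => ?_
  simp only [rotated, add_dotProduct, smul_dotProduct, smul_eq_mul]
  exact ((Real.hasDerivAt_cos θ).mul_const _).fun_add ((Real.hasDerivAt_sin θ).mul_const _)

theorem norm_rotated_le [Fintype k] (a b : k → ι → ℝ) :
    ∃ D, ∀ (θ : ℝ) (x : ι → ℝ), ‖rotated a b θ x‖ ≤ D * (1 + ‖x‖) := by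
  have h0 : ∀ i, 0 ≤ ∑ l, (|a i l| + |b i l|) := fun i => Finset.sum_nonneg fun l _ => by positivity
  refine ⟨∑ i, ∑ l, (|a i l| + |b i l|), fun θ x => ?_⟩
  have hx := norm_nonneg x
  have hD : 0 ≤ ∑ i, ∑ l, (|a i l| + |b i l|) := Finset.sum_nonneg fun i _ => h0 i
  refine (pi_norm_le_iff_of_nonneg (by positivity)).2 fun i => ?_
  calc ‖rotated a b θ x i‖ ≤ (∑ l, (|a i l| + |b i l|)) * (1 + ‖x‖) := by
        rw [rotated, dotProduct, Finset.sum_mul]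
        refine (norm_sum_le _ _).trans (Finset.sum_le_sum fun l _ => ?_)
        rw [norm_mul]
        refine mul_le_mul ?_ (by linarith [norm_le_pi_norm x l]) (norm_nonneg _) (by positivity)
        simp only [Pi.add_apply, Pi.smul_apply, smul_eq_mul, Real.norm_eq_abs]
        refine (abs_add_le _ _).trans (add_le_add ?_ ?_) <;> rw [abs_mul]
        · exact mul_le_of_le_one_left (abs_nonneg _) (Real.abs_cos_le_one θ)
        · exact mul_le_of_le_one_left (abs_nonneg _) (Real.abs_sin_le_one θ)
    _ ≤ _ := by
        gcongr
        exact Finset.single_le_sum (f := fun i => ∑ l, (|a i l| + |b i l|)) (fun i _ => h0 i)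
          (Finset.mem_univ i)

/-- The direction is the `θ`-derivative of the row `cos θ • a' i + sin θ • b' i`. Integrating by
parts along it differentiates the rotated vectors themselves; the mixed terms vanish by
orthogonality and only the covariance difference survives. -/
theorem rotated_apply_direction (a b a' b' : k → ι → ℝ) (hab : ∀ i j, a i ⬝ᵥ b' j = 0)
    (hba : ∀ i j, b i ⬝ᵥ a' j = 0) (θ : ℝ) (i j : k) :
    rotated a b θ (-Real.sin θ • a' i + Real.cos θ • b' i) j
      = Real.sin θ * Real.cos θ * (b j ⬝ᵥ b' i - a j ⬝ᵥ a' i) := by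
  simp only [rotated, add_dotProduct, dotProduct_add, smul_dotProduct, dotProduct_smul,
    smul_eq_mul, hab, hba]
  ring

end Rotation

/-! ### Gaussian interpolation for products. -/

section Interpolation

variable {ι k Z : Type*} [Fintype ι] [Fintype k] [DecidableEq k] [Fintype Z] [DecidableEq Z]

/-- A continuously differentiable function with exponential growth of itself and its gradient. -/
structure TameC1 (f : (k → ℝ) → ℝ) : Prop where
  contDiff : ContDiff ℝ 1 f
  growth : ∃ c, ∀ v, |f v| ≤ Real.exp (c * (1 + ‖v‖))
  growth_partialDeriv : ∀ i, ∃ c, ∀ v, |partialDeriv f i v| ≤ Real.exp (c * (1 + ‖v‖))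

namespace TameC1

variable {f : (k → ℝ) → ℝ}

theorem continuous (hf : TameC1 f) : Continuous f := hf.contDiff.continuous

theorem continuous_partialDeriv (hf : TameC1 f) (i : k) : Continuous (partialDeriv f i) :=
  (hf.contDiff.continuous_fderiv (by norm_num)).clm_apply continuous_const

theorem hasDerivAt_comp (hf : TameC1 f) {V : ℝ → k → ℝ} {V' : k → ℝ} {t : ℝ}
    (hV : HasDerivAt V V' t) :
    HasDerivAt (fun t => f (V t)) (∑ i, V' i * partialDeriv f i (V t)) t := by
  rw [← fderiv_apply_eq_sum_partialDeriv]
  exact ((hf.contDiff.differentiable (by norm_num)) (V t)).hasFDerivAt.comp_hasDerivAt t hV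

theorem growth_rotated (hf : TameC1 f) (a b : k → ι → ℝ) :
    UniformExpGrowth fun (θ : ℝ) (x : ι → ℝ) => f (rotated a b θ x) := by
  obtain ⟨c, hc⟩ := hf.growth
  obtain ⟨D, hD⟩ := norm_rotated_le a b
  exact UniformExpGrowth.comp hc hD

theorem growth_partialDeriv_rotated (hf : TameC1 f) (a b : k → ι → ℝ) (i : k) :
    UniformExpGrowth fun (θ : ℝ) (x : ι → ℝ) => partialDeriv f i (rotated a b θ x) := by
  obtain ⟨c, hc⟩ := hf.growth_partialDeriv i
  obtain ⟨D, hD⟩ := norm_rotated_le a b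
  exact UniformExpGrowth.comp hc hD

end TameC1

/-- Differentiating under the integral produces terms `⟨e, x⟩ G(x)` with `e` the derivative of a
row, and integration by parts along `e` replaces each by the derivative `G'` of `G`. Equal
covariances within each block (`hdiag`) remove the second derivatives of `f`, so C¹ regularity is
enough and only pairs `z ≠ w` remain. -/
theorem hasDerivAt_integral_prod_rotated {f : (k → ℝ) → ℝ} (hf : TameC1 f) (a b : Z → k → ι → ℝ)
    (hab : ∀ z w i j, a z i ⬝ᵥ b w j = 0) (hdiag : ∀ z i j, a z i ⬝ᵥ a z j = b z i ⬝ᵥ b z j)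
    (θ : ℝ) :
    HasDerivAt (fun θ => ∫ x, ∏ z, f (rotated (a z) (b z) θ x) ∂gaussianPi ι)
      (∫ x, ∑ z, ∑ w ∈ Finset.univ.erase z,
        (∏ u ∈ (Finset.univ.erase z).erase w, f (rotated (a u) (b u) θ x)) *
          (Real.sin θ * Real.cos θ * ∑ i, ∑ j, (b z i ⬝ᵥ b w j - a z i ⬝ᵥ a w j) *
            (partialDeriv f i (rotated (a z) (b z) θ x) *
              partialDeriv f j (rotated (a w) (b w) θ x))) ∂gaussianPi ι) θ := by
  have hba : ∀ z w i j, b z i ⬝ᵥ a w j = 0 := fun z w i j => by rw [dotProduct_comm, hab]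
  set e : Z → k → ℝ → ι → ℝ := fun z i θ => -Real.sin θ • a z i + Real.cos θ • b z i with he
  set G : Z → k → ℝ → (ι → ℝ) → ℝ := fun z i θ x =>
    partialDeriv f i (rotated (a z) (b z) θ x) *
      ∏ w ∈ Finset.univ.erase z, f (rotated (a w) (b w) θ x) with hG
  set G' : Z → k → ℝ → (ι → ℝ) → ℝ := fun z i θ x =>
    partialDeriv f i (rotated (a z) (b z) θ x) * ∑ w ∈ Finset.univ.erase z,
      (∏ u ∈ (Finset.univ.erase z).erase w, f (rotated (a u) (b u) θ x)) *
        ∑ j, Real.sin θ * Real.cos θ * (b w j ⬝ᵥ b z i - a w j ⬝ᵥ a z i) *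
          partialDeriv f j (rotated (a w) (b w) θ x) with hG'
  have hcr := fun z θ => continuous_rotated (a z) (b z) θ
  have cG : ∀ z i θ, Continuous (G z i θ) := fun z i θ =>
    ((hf.continuous_partialDeriv i).comp (hcr z θ)).mul
      (continuous_finsetProd _ fun w _ => hf.continuous.comp (hcr w θ))
  have cG' : ∀ z i θ, Continuous (G' z i θ) := fun z i θ =>
    ((hf.continuous_partialDeriv i).comp (hcr z θ)).mul
      (continuous_finsetSum _ fun w _ =>
        (continuous_finsetProd _ fun u _ => hf.continuous.comp (hcr u θ)).mul
          (continuous_finsetSum _ fun j _ =>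
            continuous_const.mul ((hf.continuous_partialDeriv j).comp (hcr w θ))))
  have gG : ∀ z i, UniformExpGrowth (G z i) := fun z i =>
    (hf.growth_partialDeriv_rotated (a z) (b z) i).mul
      (UniformExpGrowth.prod _ fun w _ => hf.growth_rotated (a w) (b w))
  have gG' : ∀ z i, UniformExpGrowth (G' z i) := fun z i => by
    refine (hf.growth_partialDeriv_rotated (a z) (b z) i).mul (UniformExpGrowth.sum _ fun w _ =>
      (UniformExpGrowth.prod _ fun u _ => hf.growth_rotated (a u) (b u)).mul
        (UniformExpGrowth.sum _ fun j _ => (UniformExpGrowth.of_bounded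
          (K := |b w j ⬝ᵥ b z i - a w j ⬝ᵥ a z i|) fun θ x => ?_).mul
            (hf.growth_partialDeriv_rotated (a w) (b w) j)))
    rw [abs_mul, abs_mul]
    exact mul_le_of_le_one_left (abs_nonneg _)
      (mul_le_one₀ (Real.abs_sin_le_one θ) (abs_nonneg _) (Real.abs_cos_le_one θ))
  have ge : ∀ z i, UniformExpGrowth fun θ (x : ι → ℝ) => e z i θ ⬝ᵥ x := fun z i => by
    refine ⟨∑ l, (|a z i l| + |b z i l|), fun θ x => (abs_dotProduct_le_exp _ x).trans ?_⟩
    have := norm_nonneg x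
    gcongr with l
    simp only [he, Pi.add_apply, Pi.smul_apply, smul_eq_mul]
    refine (abs_add_le _ _).trans (add_le_add ?_ ?_) <;> rw [abs_mul]
    · rw [abs_neg]
      exact mul_le_of_le_one_left (abs_nonneg _) (Real.abs_sin_le_one θ)
    · exact mul_le_of_le_one_left (abs_nonneg _) (Real.abs_cos_le_one θ)
  have hline : ∀ z i θ x, HasLineDerivAt ℝ (G z i θ) (G' z i θ x) x (e z i θ) := fun z i θ x => by
    have hV : ∀ w, HasDerivAt (fun t : ℝ => rotated (a w) (b w) θ (x + t • e z i θ))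
        (rotated (a w) (b w) θ (e z i θ)) 0 := fun w => by
      simp only [rotated_add_smul]
      simpa using ((hasDerivAt_id (0 : ℝ)).smul_const
        (rotated (a w) (b w) θ (e z i θ))).const_add (rotated (a w) (b w) θ x)
    have hVe : ∀ w j, rotated (a w) (b w) θ (e z i θ) j
        = Real.sin θ * Real.cos θ * (b w j ⬝ᵥ b z i - a w j ⬝ᵥ a z i) := fun w j =>
      rotated_apply_direction _ _ (a z) (b z) (hab w z) (hba w z) θ i j
    -- By `hdiag` the block `z` does not move along its own direction `e z i θ`, so the factor
    -- `partialDeriv f i` is constant there.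
    have hVz : ∀ t : ℝ, rotated (a z) (b z) θ (x + t • e z i θ) = rotated (a z) (b z) θ x := by
      intro t
      rw [rotated_add_smul]
      funext j
      simp only [Pi.add_apply, Pi.smul_apply, hVe, hdiag]
      simp
    unfold HasLineDerivAt
    simp only [hG, hVz]
    refine HasDerivAt.const_mul _ ?_
    have h1 := HasDerivAt.fun_finsetProd (u := Finset.univ.erase z)
      fun w _ => hf.hasDerivAt_comp (hV w)
    simpa only [zero_smul, add_zero, smul_eq_mul, hVe] using h1
  have stein : ∀ z i θ, ∫ x, (e z i θ ⬝ᵥ x) * G z i θ x ∂gaussianPi ι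
      = ∫ x, G' z i θ x ∂gaussianPi ι := fun z i θ => by
    obtain ⟨c, hc⟩ := gG z i
    obtain ⟨c', hc'⟩ := gG' z i
    refine integral_dotProduct_mul_gaussianPi _ (cG z i θ) (cG' z i θ) (hline z i θ)
      (c := max c c') (fun x => (hc θ x).trans ?_) (fun x => (hc' θ x).trans ?_)
    · have := norm_nonneg x; gcongr; exact le_max_left _ _
    · have := norm_nonneg x; gcongr; exact le_max_right _ _
  have cl : ∀ z i θ, Continuous fun x : ι → ℝ => e z i θ ⬝ᵥ x := fun z i θ => by
    simp only [dotProduct]; fun_prop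
  have gD : UniformExpGrowth fun θ x => ∑ z, ∑ i, (e z i θ ⬝ᵥ x) * G z i θ x :=
    UniformExpGrowth.sum _ fun z _ => UniformExpGrowth.sum _ fun i _ => (ge z i).mul (gG z i)
  obtain ⟨c, hc⟩ := gD
  obtain ⟨c₀, hc₀⟩ := UniformExpGrowth.prod (Finset.univ : Finset Z)
    fun z _ => hf.growth_rotated (a z) (b z)
  have hcF : ∀ θ, Continuous fun x => ∏ z, f (rotated (a z) (b z) θ x) := fun θ =>
    continuous_finsetProd _ fun w _ => hf.continuous.comp (hcr w θ)
  -- The growth bound is uniform in `θ`, so a single integrable function dominates all the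
  -- derivatives.
  have main := (hasDerivAt_integral_of_dominated_loc_of_deriv_le (μ := gaussianPi ι)
    (F := fun θ x => ∏ z, f (rotated (a z) (b z) θ x)) (x₀ := θ) (s := Set.univ)
    (F' := fun θ x => ∑ z, ∑ i, (e z i θ ⬝ᵥ x) * G z i θ x)
    (bound := fun x => Real.exp (c * (1 + ‖x‖))) Filter.univ_mem
    (Filter.Eventually.of_forall fun θ => (hcF θ).aestronglyMeasurable)
    (integrable_gaussianPi_of_le_exp (hcF θ) (hc₀ θ))
    (continuous_finsetSum _ fun z _ => continuous_finsetSum _ fun i _ =>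
      (cl z i θ).mul (cG z i θ)).aestronglyMeasurable
    (Filter.Eventually.of_forall fun x θ _ => hc θ x)
    (integrable_exp_norm_gaussianPi c)
    (Filter.Eventually.of_forall fun x θ _ => by
      have h1 := HasDerivAt.fun_finsetProd (u := Finset.univ)
        fun w _ => hf.hasDerivAt_comp (hasDerivAt_rotated (a w) (b w) x θ)
      convert! h1 using 1
      refine Finset.sum_congr rfl fun z _ => ?_
      rw [smul_eq_mul, Finset.mul_sum]
      refine Finset.sum_congr rfl fun i _ => ?_
      simp only [hG, he]
      ring)).2
  convert! main using 1
  have iGe : ∀ z i, Integrable (fun x => (e z i θ ⬝ᵥ x) * G z i θ x) (gaussianPi ι) := fun z i => by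
    obtain ⟨c, hc⟩ := (ge z i).mul (gG z i)
    exact integrable_gaussianPi_of_le_exp ((cl z i θ).mul (cG z i θ)) (hc θ)
  have iG' : ∀ z i, Integrable (G' z i θ) (gaussianPi ι) := fun z i => by
    obtain ⟨c, hc⟩ := gG' z i
    exact integrable_gaussianPi_of_le_exp (cG' z i θ) (hc θ)
  calc _ = ∫ x, ∑ z, ∑ i, G' z i θ x ∂gaussianPi ι := by
        congr 1
        funext x
        refine Finset.sum_congr rfl fun z _ => ?_
        simp only [hG', Finset.mul_sum]
        rw [Finset.sum_comm]
        refine Finset.sum_congr rfl fun i _ => Finset.sum_congr rfl fun w _ =>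
          Finset.sum_congr rfl fun j _ => ?_
        rw [dotProduct_comm (b w j), dotProduct_comm (a w j)]
        ring
    _ = ∑ z, ∑ i, ∫ x, G' z i θ x ∂gaussianPi ι := by
        rw [integral_finsetSum _ fun z _ => integrable_finsetSum _ fun i _ => iG' z i]
        exact Finset.sum_congr rfl fun z _ => integral_finsetSum _ fun i _ => iG' z i
    _ = ∑ z, ∑ i, ∫ x, (e z i θ ⬝ᵥ x) * G z i θ x ∂gaussianPi ι := by simp only [stein]
    _ = _ := by
        rw [integral_finsetSum _ fun z _ => integrable_finsetSum _ fun i _ => iGe z i]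
        exact Finset.sum_congr rfl fun z _ => (integral_finsetSum _ fun i _ => iGe z i).symm

/-- Comparison of Gaussian expectations of products along the path `cos θ • A x + sin θ • B x`. -/
theorem integral_prod_le_of_partialDeriv_le {f : (k → ℝ) → ℝ} (hf : TameC1 f)
    (hf0 : ∀ v, 0 ≤ f v) (a b : Z → k → ι → ℝ) (hab : ∀ z w i j, a z i ⬝ᵥ b w j = 0)
    (hdiag : ∀ z i j, a z i ⬝ᵥ a z j = b z i ⬝ᵥ b z j) {C : ℝ}
    (hC : ∀ z w, z ≠ w → ∀ u v : k → ℝ, ∑ i, ∑ j, (b z i ⬝ᵥ b w j - a z i ⬝ᵥ a w j) *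
      (partialDeriv f i u * partialDeriv f j v) ≤ C * (f u * f v)) :
    ∫ x, ∏ z, f (fun i => b z i ⬝ᵥ x) ∂gaussianPi ι
      ≤ Real.exp (Fintype.card Z * (Fintype.card Z - 1) * C / 2) *
        ∫ x, ∏ z, f (fun i => a z i ⬝ᵥ x) ∂gaussianPi ι := by
  set n : ℝ := (Fintype.card Z : ℝ) with hn
  set φ : ℝ → ℝ := fun θ => ∫ x, ∏ z, f (rotated (a z) (b z) θ x) ∂gaussianPi ι with hφ
  have hd := hasDerivAt_integral_prod_rotated hf a b hab hdiag
  set φ' : ℝ → ℝ := fun θ => ∫ x, ∑ z, ∑ w ∈ Finset.univ.erase z,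
        (∏ u ∈ (Finset.univ.erase z).erase w, f (rotated (a u) (b u) θ x)) *
          (Real.sin θ * Real.cos θ * ∑ i, ∑ j, (b z i ⬝ᵥ b w j - a z i ⬝ᵥ a w j) *
            (partialDeriv f i (rotated (a z) (b z) θ x) *
              partialDeriv f j (rotated (a w) (b w) θ x))) ∂gaussianPi ι with hφ'
  have hle : ∀ θ ∈ Set.Ioo 0 (Real.pi / 2),
      φ' θ ≤ n * (n - 1) * C * (Real.sin θ * Real.cos θ) * φ θ := by
    intro θ hθ
    have hs : 0 ≤ Real.sin θ * Real.cos θ :=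
      mul_nonneg (Real.sin_nonneg_of_nonneg_of_le_pi hθ.1.le (by linarith [hθ.2, Real.pi_pos]))
        (Real.cos_nonneg_of_neg_pi_div_two_le_of_le (by linarith [hθ.1, Real.pi_pos]) hθ.2.le)
    have hcr := fun z => continuous_rotated (a z) (b z) θ
    have i1 : Integrable (fun x => ∏ z, f (rotated (a z) (b z) θ x)) (gaussianPi ι) := by
      obtain ⟨c, hc⟩ := UniformExpGrowth.prod (Finset.univ : Finset Z)
        fun z _ => hf.growth_rotated (a z) (b z)
      exact integrable_gaussianPi_of_le_exp
        (continuous_finsetProd _ fun w _ => hf.continuous.comp (hcr w)) (hc θ)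
    rw [hφ', hφ]
    simp only
    rw [← integral_const_mul]
    refine integral_mono ?_ (i1.const_mul _) fun x => ?_
    · have gD := UniformExpGrowth.sum (Finset.univ : Finset Z) fun z _ =>
        UniformExpGrowth.sum (Finset.univ.erase z) fun w _ =>
        (UniformExpGrowth.prod ((Finset.univ.erase z).erase w) fun u _ =>
          hf.growth_rotated (a u) (b u)).mul
        ((UniformExpGrowth.of_bounded (g := fun (θ : ℝ) (_ : ι → ℝ) => Real.sin θ * Real.cos θ)
          (K := 1) fun θ x => by
            rw [abs_mul]
            exact mul_le_one₀ (Real.abs_sin_le_one θ) (abs_nonneg _) (Real.abs_cos_le_one θ)).mul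
          (UniformExpGrowth.sum Finset.univ fun i _ => UniformExpGrowth.sum Finset.univ fun j _ =>
            (UniformExpGrowth.of_bounded
              (g := fun (_ : ℝ) (_ : ι → ℝ) => b z i ⬝ᵥ b w j - a z i ⬝ᵥ a w j)
              fun _ _ => le_rfl).mul
            ((hf.growth_partialDeriv_rotated (a z) (b z) i).mul
              (hf.growth_partialDeriv_rotated (a w) (b w) j))))
      obtain ⟨c, hc⟩ := gD
      refine integrable_gaussianPi_of_le_exp ?_ (hc θ)
      exact continuous_finsetSum _ fun z _ => continuous_finsetSum _ fun w _ =>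
        (continuous_finsetProd _ fun u _ => hf.continuous.comp (hcr u)).mul
        (continuous_const.mul (continuous_finsetSum _ fun i _ => continuous_finsetSum _ fun j _ =>
          continuous_const.mul (((hf.continuous_partialDeriv i).comp (hcr z)).mul
            ((hf.continuous_partialDeriv j).comp (hcr w)))))
    -- Each ordered pair of distinct indices contributes at most `C sin θ cos θ` times the full
    -- product; there are `n (n - 1)` such pairs.
    · calc _ ≤ ∑ z : Z, ∑ w ∈ Finset.univ.erase z,
            C * (Real.sin θ * Real.cos θ) * ∏ z, f (rotated (a z) (b z) θ x) := by
            refine Finset.sum_le_sum fun z _ => Finset.sum_le_sum fun w hw => ?_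
            have h2 : ∏ z, f (rotated (a z) (b z) θ x) = f (rotated (a z) (b z) θ x) *
                (f (rotated (a w) (b w) θ x) *
                  ∏ u ∈ (Finset.univ.erase z).erase w, f (rotated (a u) (b u) θ x)) := by
              rw [Finset.mul_prod_erase _ (fun u => f (rotated (a u) (b u) θ x)) hw,
                Finset.mul_prod_erase _ (fun u => f (rotated (a u) (b u) θ x)) (Finset.mem_univ z)]
            have h3 := hC z w (Finset.ne_of_mem_erase hw).symm (rotated (a z) (b z) θ x)
              (rotated (a w) (b w) θ x)
            have h4 : 0 ≤ ∏ u ∈ (Finset.univ.erase z).erase w, f (rotated (a u) (b u) θ x) :=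
              Finset.prod_nonneg fun u _ => hf0 _
            rw [h2]
            refine (mul_le_mul_of_nonneg_left (mul_le_mul_of_nonneg_left h3 hs) h4).trans_eq ?_
            ring
        _ = _ := by
            simp only [Finset.sum_const, Finset.card_erase_of_mem (Finset.mem_univ _),
              Finset.card_univ, nsmul_eq_mul]
            -- The number `card Z - 1` is a truncated subtraction, so an empty `Z` is treated apart.
            rcases Nat.eq_zero_or_pos (Fintype.card Z) with h0 | h0
            · simp [hn, h0]
            · rw [Nat.cast_sub h0, hn]; push_cast; ring
  -- Integrating factor for `φ' ≤ n (n - 1) C sin θ cos θ · φ`. The exponent is minus an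
  -- antiderivative of the coefficient; it is `0` at `θ = 0` and `-n (n - 1) C / 2` at `θ = π / 2`.
  set E : ℝ → ℝ := fun θ => Real.exp (-(n * (n - 1) * C / 2) * Real.sin θ ^ 2) with hE
  have hEd : ∀ θ, HasDerivAt E (E θ * (-(n * (n - 1) * C) * (Real.sin θ * Real.cos θ))) θ := by
    intro θ
    have h1 := (((Real.hasDerivAt_sin θ).fun_pow 2).const_mul (-(n * (n - 1) * C / 2))).exp
    convert! h1 using 1
    simp only [hE]
    push_cast
    ring
  have hgd : ∀ θ, HasDerivAt (fun θ => φ θ * E θ)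
      (φ' θ * E θ + φ θ * (E θ * (-(n * (n - 1) * C) * (Real.sin θ * Real.cos θ)))) θ :=
    fun θ => (hd θ).fun_mul (hEd θ)
  have hanti : AntitoneOn (fun θ => φ θ * E θ) (Set.Icc 0 (Real.pi / 2)) := by
    refine antitoneOn_of_deriv_nonpos (convex_Icc _ _)
      (fun θ _ => (hgd θ).continuousAt.continuousWithinAt)
      (fun θ _ => (hgd θ).differentiableAt.differentiableWithinAt) fun θ hθ => ?_
    rw [interior_Icc] at hθ
    rw [(hgd θ).deriv]
    have hEp : 0 < E θ := Real.exp_pos _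
    nlinarith [mul_le_mul_of_nonneg_right (hle θ hθ) hEp.le]
  have hpi := Real.pi_pos
  have h0 := hanti (Set.left_mem_Icc.2 (by positivity)) (Set.right_mem_Icc.2 (by positivity))
    (by positivity : (0 : ℝ) ≤ Real.pi / 2)
  have e0 : φ 0 = ∫ x, ∏ z, f (fun i => a z i ⬝ᵥ x) ∂gaussianPi ι := by
    simp [hφ]
  have e1 : φ (Real.pi / 2) = ∫ x, ∏ z, f (fun i => b z i ⬝ᵥ x) ∂gaussianPi ι := by
    simp [hφ]
  simp only [e0, e1, hE, Real.sin_zero, Real.sin_pi_div_two] at h0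
  have h1 : Real.exp (n * (n - 1) * C / 2) * Real.exp (-(n * (n - 1) * C / 2) * 1 ^ 2) = 1 := by
    rw [← Real.exp_add]; simp
  have h2 := mul_le_mul_of_nonneg_left h0 (Real.exp_pos (n * (n - 1) * C / 2)).le
  simp only [ne_eq, OfNat.ofNat_ne_zero, not_false_eq_true, zero_pow, mul_zero, Real.exp_zero,
    mul_one] at h2
  calc _ = (Real.exp (n * (n - 1) * C / 2) * Real.exp (-(n * (n - 1) * C / 2) * 1 ^ 2)) *
        ∫ x, ∏ z, f (fun i => b z i ⬝ᵥ x) ∂gaussianPi ι := by rw [h1, one_mul]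
    _ ≤ _ := by refine le_trans (le_of_eq ?_) h2; ring

end Interpolation

/-! ### Marginals and independent blocks of a Gaussian family. -/

section Marginals

theorem measurePreserving_comp_gaussianPi {α ι : Type*} [Fintype α] [Fintype ι] {e : α → ι}
    (he : Function.Injective e) :
    MeasurePreserving (fun (x : ι → ℝ) (i : α) => x (e i)) (gaussianPi ι) (gaussianPi α) := by
  have h1 : iIndepFun (fun (i : ι) (x : ι → ℝ) => x i) (gaussianPi ι) :=
    iIndepFun_pi (X := fun _ => id) fun _ => aemeasurable_id
  have h2 := iIndepFun.hasLaw_pi (P := gaussianPi ι) (X := fun (i : α) (x : ι → ℝ) => x (e i))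
    (μ := fun _ => gaussianReal 0 1)
    (fun i => (measurePreserving_eval (fun _ : ι => gaussianReal 0 1) (e i)).hasLaw)
    (h1.precomp he)
  exact ⟨by fun_prop, h2.map_eq⟩

theorem integral_prod_gaussianPi {I k : Type*} [Fintype I] [Fintype k] (f : (k → ℝ) → ℝ) :
    ∫ x : I × k → ℝ, ∏ i, f (fun j => x (i, j)) ∂gaussianPi (I × k)
      = (∫ v, f v ∂gaussianPi k) ^ Fintype.card I := by
  have h := Measure.infinitePi_map_curry (ι := I) (κ := k) (fun _ _ => gaussianReal 0 1)
  simp only [Measure.infinitePi_eq_pi] at h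
  have h2 : MeasurePreserving (MeasurableEquiv.curry I k ℝ) (gaussianPi (I × k))
      (Measure.pi fun _ : I => gaussianPi k) := ⟨(MeasurableEquiv.curry I k ℝ).measurable, h⟩
  have h3 := h2.integral_comp' (fun y : I → k → ℝ => ∏ i, f (y i))
  rw [integral_fintype_prod_eq_pow] at h3
  exact h3

end Marginals

/-! ### Sharp exponential concentration. -/

section Concentration

variable {k : Type*} [Fintype k] [DecidableEq k]

theorem partialDeriv_exp_mul {F : (k → ℝ) → ℝ} (hF : ContDiff ℝ 1 F) (s : ℝ) (i : k)
    (v : k → ℝ) :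
    partialDeriv (fun v => Real.exp (s * F v)) i v
      = Real.exp (s * F v) * (s * partialDeriv F i v) := by
  have h := (((hF.differentiable (by norm_num)) v).hasFDerivAt.const_mul s).exp
  simp [partialDeriv, h.fderiv]

/-- A bounded gradient makes `F` Lipschitz, hence of linear growth; this supplies the exponential
bounds needed for interpolation. -/
theorem exists_abs_le_of_sum_sq_partialDeriv_le {F : (k → ℝ) → ℝ} (hF : ContDiff ℝ 1 F) {L : ℝ}
    (hL : ∀ v, ∑ i, partialDeriv F i v ^ 2 ≤ L) : ∃ c, ∀ v, |F v| ≤ c * (1 + ‖v‖) := by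
  have h1 : ∀ v, ‖fderiv ℝ F v‖ ≤ Fintype.card k * Real.sqrt L := fun v => by
    refine ContinuousLinearMap.opNorm_le_bound _ (by positivity) fun w => ?_
    rw [fderiv_apply_eq_sum_partialDeriv]
    refine (norm_sum_le _ _).trans ?_
    refine (Finset.sum_le_card_nsmul _ _ (Real.sqrt L * ‖w‖) fun i _ => ?_).trans_eq
      (by simp [mul_assoc])
    rw [norm_mul, mul_comm]
    refine mul_le_mul (Real.abs_le_sqrt ?_) (norm_le_pi_norm w i) (norm_nonneg _)
      (Real.sqrt_nonneg _)
    exact (Finset.single_le_sum (f := fun i => partialDeriv F i v ^ 2)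
      (fun i _ => sq_nonneg _) (Finset.mem_univ i)).trans (hL v)
  refine ⟨|F 0| + Fintype.card k * Real.sqrt L, fun v => ?_⟩
  have h2 := convex_univ.norm_image_sub_le_of_norm_fderiv_le (𝕜 := ℝ) (f := F) (x := 0) (y := v)
    (fun x _ => hF.differentiable (by norm_num) x) (fun x _ => h1 x) trivial trivial
  rw [sub_zero, Real.norm_eq_abs] at h2
  have h3 := abs_sub_abs_le_abs_sub (F v) (F 0)
  have h4 : 0 ≤ |F 0| * ‖v‖ := by positivity
  have h5 : 0 ≤ Fintype.card k * Real.sqrt L := by positivity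
  nlinarith

theorem tameC1_exp_mul {F : (k → ℝ) → ℝ} (hF : ContDiff ℝ 1 F) {L : ℝ}
    (hL : ∀ v, ∑ i, partialDeriv F i v ^ 2 ≤ L) (s : ℝ) :
    TameC1 fun v => Real.exp (s * F v) := by
  obtain ⟨c, hc⟩ := exists_abs_le_of_sum_sq_partialDeriv_le hF hL
  have g : ∀ v, |Real.exp (s * F v)| ≤ Real.exp ((|s| * c) * (1 + ‖v‖)) := fun v => by
    rw [Real.abs_exp, mul_assoc]
    refine Real.exp_le_exp.2 ((le_abs_self _).trans ?_)
    rw [abs_mul]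
    exact mul_le_mul_of_nonneg_left (hc v) (abs_nonneg _)
  refine ⟨(contDiff_const.mul hF).exp, ⟨_, g⟩, fun i => ?_⟩
  have g1 : UniformExpGrowth fun (_ : Unit) v => Real.exp (s * F v) := ⟨_, fun _ => g⟩
  have g2 : UniformExpGrowth fun (_ : Unit) v => s * partialDeriv F i v :=
    UniformExpGrowth.of_bounded (K := |s| * Real.sqrt L) fun _ v => by
      rw [abs_mul]
      refine mul_le_mul_of_nonneg_left (Real.abs_le_sqrt ?_) (abs_nonneg _)
      exact (Finset.single_le_sum (f := fun i => partialDeriv F i v ^ 2)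
        (fun i _ => sq_nonneg _) (Finset.mem_univ i)).trans (hL v)
  obtain ⟨c', hc'⟩ := g1.mul g2
  exact ⟨c', fun v => by rw [partialDeriv_exp_mul hF]; exact hc' () v⟩

/-- The interpolation is applied to `q` factors `f = e^{F/q}`, from `q` independent arguments (the
blocks `some z`) to a single common argument (the block `none`), where the product becomes `e^F`.
Across distinct factors the covariance changes from `0` to the identity, so `C = L / q²`, and the
exponent `q (q - 1) C / 2` stays below `L / 2`. -/
theorem integral_exp_le_pow {F : (k → ℝ) → ℝ} (hF : ContDiff ℝ 1 F) {L : ℝ}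
    (hL : ∀ v, ∑ i, partialDeriv F i v ^ 2 ≤ L)
    {q : ℕ} (hq : 0 < q) :
    ∫ v, Real.exp (F v) ∂gaussianPi k
      ≤ Real.exp (L / 2) * (∫ v, Real.exp ((q : ℝ)⁻¹ * F v) ∂gaussianPi k) ^ q := by
  have hL0 : 0 ≤ L := (Finset.sum_nonneg fun i _ => sq_nonneg _).trans (hL 0)
  have hq' : (0 : ℝ) < q := by exact_mod_cast hq
  set f : (k → ℝ) → ℝ := fun v => Real.exp ((q : ℝ)⁻¹ * F v) with hf
  have key := integral_prod_le_of_partialDeriv_le (Z := Fin q) (ι := Option (Fin q) × k) (f := f)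
    (tameC1_exp_mul hF hL _) (fun v => (Real.exp_pos _).le)
    (fun z i => Pi.single (some z, i) 1) (fun _ i => Pi.single (none, i) 1)
    (fun z w i j => by simp) (fun z i j => by simp [Pi.single_apply])
    (C := ((q : ℝ)⁻¹) ^ 2 * L) (fun z w hzw u v => by
      have h1 : ∀ i j : k, (Pi.single (none, i) 1 : Option (Fin q) × k → ℝ) ⬝ᵥ
          Pi.single (none, j) 1 - (Pi.single (some z, i) 1 : Option (Fin q) × k → ℝ) ⬝ᵥ
            Pi.single (some w, j) 1 = if i = j then 1 else 0 := fun i j => by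
        simp [Pi.single_apply, hzw, eq_comm]
      simp only [h1, ite_mul, one_mul, zero_mul, Finset.sum_ite_eq, Finset.mem_univ, if_true]
      simp only [hf, partialDeriv_exp_mul hF]
      have h2 : ∑ i, partialDeriv F i u * partialDeriv F i v ≤ L := by
        have : ∑ i, partialDeriv F i u * partialDeriv F i v
            ≤ ∑ i, (partialDeriv F i u ^ 2 + partialDeriv F i v ^ 2) / 2 :=
          Finset.sum_le_sum fun i _ => by
            nlinarith [sq_nonneg (partialDeriv F i u - partialDeriv F i v)]
        rw [← Finset.sum_div, Finset.sum_add_distrib] at this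
        linarith [hL u, hL v]
      calc _ = ((q : ℝ)⁻¹) ^ 2 * (∑ i, partialDeriv F i u * partialDeriv F i v) *
            (Real.exp ((q : ℝ)⁻¹ * F u) * Real.exp ((q : ℝ)⁻¹ * F v)) := by
            rw [Finset.mul_sum, Finset.sum_mul]
            exact Finset.sum_congr rfl fun i _ => by ring
        _ ≤ _ := by gcongr)
  simp only [single_dotProduct, one_mul, Finset.prod_const, Finset.card_univ,
    Fintype.card_fin] at key
  have e1 : ∫ x : Option (Fin q) × k → ℝ, f (fun i => x (none, i)) ^ q ∂gaussianPi _
      = ∫ v, Real.exp (F v) ∂gaussianPi k := by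
    have hm := measurePreserving_comp_gaussianPi (α := k) (ι := Option (Fin q) × k)
      (e := fun i => (none, i)) (fun i j h => by simpa using h)
    rw [← hm.map_eq, integral_map hm.measurable.aemeasurable]
    · congr 1
      funext x
      rw [hf, ← Real.exp_nat_mul]
      congr 1
      field_simp
    · exact (Real.continuous_exp.comp hF.continuous).aestronglyMeasurable
  have e2 : ∫ x : Option (Fin q) × k → ℝ, ∏ z : Fin q, f (fun i => x (some z, i)) ∂gaussianPi _
      = (∫ v, f v ∂gaussianPi k) ^ q := by
    have hm := measurePreserving_comp_gaussianPi (α := Fin q × k) (ι := Option (Fin q) × k)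
      (e := fun p => (some p.1, p.2)) (fun p p' h => by simpa [Prod.ext_iff] using h)
    have h3 := integral_prod_gaussianPi (I := Fin q) f
    rw [Fintype.card_fin] at h3
    rw [← h3, ← hm.map_eq, integral_map hm.measurable.aemeasurable]
    refine Continuous.aestronglyMeasurable (continuous_finsetProd _ fun i _ => ?_)
    have := hF.continuous
    simp only [hf]
    fun_prop
  rw [e1, e2] at key
  refine key.trans ?_
  have h4 : 0 ≤ ∫ v, f v ∂gaussianPi k := integral_nonneg fun v => (Real.exp_pos _).le
  gcongr
  calc (q : ℝ) * (q - 1) * (((q : ℝ)⁻¹) ^ 2 * L) = L - (q : ℝ)⁻¹ * L := by field_simp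
    _ ≤ L := by linarith [mul_nonneg (inv_pos.2 hq').le hL0]

/-- The sharp exponential concentration inequality for Gaussian variables. -/
theorem integral_exp_le {F : (k → ℝ) → ℝ} (hF : ContDiff ℝ 1 F) {L : ℝ}
    (hL : ∀ v, ∑ i, partialDeriv F i v ^ 2 ≤ L) :
    ∫ v, Real.exp (F v) ∂gaussianPi k ≤ Real.exp ((∫ v, F v ∂gaussianPi k) + L / 2) := by
  have hint : ∀ t, Integrable (fun v => Real.exp (t * F v)) (gaussianPi k) := fun t => by
    obtain ⟨c', hc'⟩ := (tameC1_exp_mul hF hL t).growth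
    exact integrable_gaussianPi_of_le_exp (tameC1_exp_mul hF hL t).continuous hc'
  have h0 : (0 : ℝ) ∈ interior (integrableExpSet F (gaussianPi k)) := by
    have : integrableExpSet F (gaussianPi k) = Set.univ := Set.eq_univ_of_forall hint
    simp [this]
  have hd : HasDerivAt (cgf F (gaussianPi k)) (∫ v, F v ∂gaussianPi k) 0 := by
    have h1 := (analyticAt_cgf h0).differentiableAt.hasDerivAt
    rwa [deriv_cgf_zero h0, probReal_univ, div_one] at h1
  -- The logarithm of `(𝔼 e^{F/q})^q` is the slope of the cumulant generating function between `0`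
  -- and `1/q`; as `q → ∞` it tends to the derivative at `0`, the mean of `F`.
  have h2 := hasDerivAt_iff_tendsto_slope_zero.1 hd
  have h3 : Filter.Tendsto (fun n : ℕ => ((n : ℝ) + 1)⁻¹) Filter.atTop (nhdsWithin 0 {0}ᶜ) := by
    refine tendsto_nhdsWithin_iff.2 ⟨?_, Filter.Eventually.of_forall fun n => ?_⟩
    · simpa using tendsto_one_div_add_atTop_nhds_zero_nat (𝕜 := ℝ)
    · have : ((n : ℝ) + 1)⁻¹ ≠ 0 := by positivity
      exact this
  have h4 := ((Real.continuous_exp.tendsto _).comp (h2.comp h3)).const_mul (Real.exp (L / 2))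
  rw [← Real.exp_add, add_comm] at h4
  refine ge_of_tendsto' h4 fun n => ?_
  refine (integral_exp_le_pow hF hL n.succ_pos).trans_eq ?_
  congr 1
  have hpos : 0 < mgf F (gaussianPi k) ((n : ℝ) + 1)⁻¹ := mgf_pos (hint _)
  simp only [Function.comp, zero_add, cgf_zero, sub_zero, smul_eq_mul, inv_inv]
  rw [cgf, ← Nat.cast_succ, Real.exp_nat_mul, Real.exp_log (by simpa using hpos), mgf]

theorem integral_exp_mul_le {F : (k → ℝ) → ℝ} (hF : ContDiff ℝ 1 F) {L : ℝ}
    (hL : ∀ v, ∑ i, partialDeriv F i v ^ 2 ≤ L) (s : ℝ) :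
    ∫ v, Real.exp (s * F v) ∂gaussianPi k
      ≤ Real.exp (s * (∫ v, F v ∂gaussianPi k) + s ^ 2 / 2 * L) := by
  have h1 : ∀ i v, partialDeriv (fun v => s * F v) i v = s * partialDeriv F i v := fun i v => by
    simp [partialDeriv, ((hF.differentiable (by norm_num) v).hasFDerivAt.const_mul s).fderiv]
  have h2 := integral_exp_le (contDiff_const.mul hF : ContDiff ℝ 1 fun v => s * F v)
    (L := s ^ 2 * L) fun v => by
      simp only [h1, mul_pow, ← Finset.mul_sum]
      exact mul_le_mul_of_nonneg_left (hL v) (sq_nonneg s)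
  rw [integral_const_mul] at h2
  exact h2.trans_eq (by ring_nf)

theorem integrable_of_sum_sq_partialDeriv_le {F : (k → ℝ) → ℝ} (hF : ContDiff ℝ 1 F) {L : ℝ}
    (hL : ∀ v, ∑ i, partialDeriv F i v ^ 2 ≤ L) : Integrable F (gaussianPi k) := by
  obtain ⟨c, hc⟩ := exists_abs_le_of_sum_sq_partialDeriv_le hF hL
  exact integrable_gaussianPi_of_le_exp hF.continuous fun v =>
    (hc v).trans ((by linarith : c * (1 + ‖v‖) ≤ c * (1 + ‖v‖) + 1).trans (Real.add_one_le_exp _))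

end Concentration

/-! ### A smooth Euclidean norm with gradient of length at most 1. -/

theorem dotProduct_self_nonneg_real {k : Type*} [Fintype k] (v : k → ℝ) : 0 ≤ v ⬝ᵥ v :=
  Finset.sum_nonneg fun i _ => mul_self_nonneg (v i)

section SmoothNorm

variable {k : Type*} [Fintype k]

/-- The smooth approximation `√(‖v‖₂² + δ²)` of the Euclidean norm. -/
noncomputable def smoothNorm (δ : ℝ) (v : k → ℝ) : ℝ :=
  Real.sqrt (v ⬝ᵥ v + δ ^ 2)

theorem smoothNorm_sq (δ : ℝ) (v : k → ℝ) : smoothNorm δ v ^ 2 = v ⬝ᵥ v + δ ^ 2 :=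
  Real.sq_sqrt (add_nonneg (dotProduct_self_nonneg_real v) (sq_nonneg δ))

theorem smoothNorm_arg_pos {δ : ℝ} (hδ : 0 < δ) (v : k → ℝ) : 0 < v ⬝ᵥ v + δ ^ 2 :=
  add_pos_of_nonneg_of_pos (dotProduct_self_nonneg_real v) (by positivity)

theorem smoothNorm_pos {δ : ℝ} (hδ : 0 < δ) (v : k → ℝ) : 0 < smoothNorm δ v :=
  Real.sqrt_pos.2 (smoothNorm_arg_pos hδ v)

theorem smoothNorm_le {δ : ℝ} (hδ : 0 ≤ δ) (v : k → ℝ) :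
    smoothNorm δ v ≤ Real.sqrt (v ⬝ᵥ v) + δ := by
  refine (Real.sqrt_le_sqrt ?_).trans_eq (Real.sqrt_sq (by positivity))
  have h := Real.sq_sqrt (dotProduct_self_nonneg_real v)
  have := mul_nonneg (Real.sqrt_nonneg (v ⬝ᵥ v)) hδ
  nlinarith

theorem contDiff_smoothNorm {δ : ℝ} (hδ : 0 < δ) : ContDiff ℝ 1 (smoothNorm (k := k) δ) := by
  unfold smoothNorm
  refine ContDiff.sqrt ?_ fun v => (smoothNorm_arg_pos hδ v).ne'
  simp only [dotProduct]
  fun_prop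

variable [DecidableEq k]

theorem partialDeriv_eq_of_hasDerivAt {f : (k → ℝ) → ℝ} {v : k → ℝ} {i : k} {d : ℝ}
    (hf : DifferentiableAt ℝ f v)
    (h : HasDerivAt (fun t : ℝ => f (v + t • (Pi.single i 1 : k → ℝ))) d 0) :
    partialDeriv f i v = d :=
  HasLineDerivAt.unique (hf.hasFDerivAt.hasLineDerivAt _) h

theorem partialDeriv_comp {f : (k → ℝ) → ℝ} {T : ℝ → ℝ} {v : k → ℝ}
    (hf : DifferentiableAt ℝ f v) (hT : DifferentiableAt ℝ T (f v)) (i : k) :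
    partialDeriv (fun v => T (f v)) i v = deriv T (f v) * partialDeriv f i v := by
  have h := hT.hasDerivAt.comp_hasFDerivAt v hf.hasFDerivAt
  have h' : fderiv ℝ (fun v => T (f v)) v = deriv T (f v) • fderiv ℝ f v := h.fderiv
  simp [partialDeriv, h']

theorem hasDerivAt_smoothNorm_line {δ : ℝ} (hδ : 0 < δ) (v : k → ℝ) (i : k) :
    HasDerivAt (fun t : ℝ => smoothNorm δ (v + t • (Pi.single i 1 : k → ℝ)))
      (v i / smoothNorm δ v) 0 := by
  have h1 : ∀ t : ℝ, (v + t • (Pi.single i 1 : k → ℝ)) ⬝ᵥ (v + t • (Pi.single i 1 : k → ℝ)) + δ ^ 2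
      = (v ⬝ᵥ v + δ ^ 2) + (2 * v i) * t + t ^ 2 := fun t => by
    simp only [add_dotProduct, dotProduct_add, smul_dotProduct, dotProduct_smul, smul_eq_mul,
      single_dotProduct, dotProduct_single, Pi.add_apply, Pi.smul_apply, Pi.single_eq_same]
    ring
  have h2 : HasDerivAt (fun t : ℝ => (v ⬝ᵥ v + δ ^ 2) + (2 * v i) * t + t ^ 2) (2 * v i) 0 := by
    simpa using (((hasDerivAt_id (0 : ℝ)).const_mul (2 * v i)).const_add
      (v ⬝ᵥ v + δ ^ 2)).fun_add ((hasDerivAt_id (0 : ℝ)).fun_pow 2)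
  unfold smoothNorm
  simp only [h1]
  have h3 := h2.sqrt (by simpa using (smoothNorm_arg_pos hδ v).ne')
  convert! h3 using 1
  simp only [mul_zero, add_zero, ne_eq, OfNat.ofNat_ne_zero, not_false_eq_true, zero_pow]
  rw [mul_div_mul_left _ _ two_ne_zero]

theorem partialDeriv_smoothNorm {δ : ℝ} (hδ : 0 < δ) (i : k) (v : k → ℝ) :
    partialDeriv (smoothNorm δ) i v = v i / smoothNorm δ v :=
  partialDeriv_eq_of_hasDerivAt ((contDiff_smoothNorm hδ).differentiable (by norm_num) v)
    (hasDerivAt_smoothNorm_line hδ v i)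

theorem sum_sq_partialDeriv_smoothNorm_le {δ : ℝ} (hδ : 0 < δ) (v : k → ℝ) :
    ∑ i, partialDeriv (smoothNorm δ) i v ^ 2 ≤ 1 := by
  simp only [partialDeriv_smoothNorm hδ, div_pow]
  rw [← Finset.sum_div, div_le_one (pow_pos (smoothNorm_pos hδ v) 2), smoothNorm_sq]
  have : ∑ i, v i ^ 2 = v ⬝ᵥ v := by simp [dotProduct, sq]
  rw [this]
  linarith [sq_nonneg δ]

theorem sum_partialDeriv_smoothNorm_mul_le {δ : ℝ} (hδ : 0 < δ) (u v : k → ℝ) :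
    ∑ i, partialDeriv (smoothNorm δ) i u * partialDeriv (smoothNorm δ) i v ≤ 1 := by
  have h : ∑ i, partialDeriv (smoothNorm δ) i u * partialDeriv (smoothNorm δ) i v
      ≤ ∑ i, (partialDeriv (smoothNorm δ) i u ^ 2 + partialDeriv (smoothNorm δ) i v ^ 2) / 2 :=
    Finset.sum_le_sum fun i _ => by
      nlinarith [sq_nonneg (partialDeriv (smoothNorm δ) i u - partialDeriv (smoothNorm δ) i v)]
  rw [← Finset.sum_div, Finset.sum_add_distrib] at h
  linarith [sum_sq_partialDeriv_smoothNorm_le hδ u, sum_sq_partialDeriv_smoothNorm_le hδ v]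

end SmoothNorm

/-! ### Gordon's comparison for smooth increasing functions. -/

section Gordon

variable {I J : Type*} [Fintype I] [DecidableEq I] [Fintype J] [DecidableEq J]

/-- The function `(v, c) ↦ √(‖v‖₂² + δ²) + c`. -/
noncomputable def shiftedNorm (δ : ℝ) (v : Option I → ℝ) : ℝ :=
  smoothNorm δ (fun i => v (some i)) + v none

omit [DecidableEq I] in
theorem contDiff_shiftedNorm {δ : ℝ} (hδ : 0 < δ) : ContDiff ℝ 1 (shiftedNorm (I := I) δ) :=
  ((contDiff_smoothNorm hδ).comp (by fun_prop)).add (by fun_prop)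

theorem partialDeriv_shiftedNorm_some {δ : ℝ} (hδ : 0 < δ) (i : I) (v : Option I → ℝ) :
    partialDeriv (shiftedNorm δ) (some i) v
      = partialDeriv (smoothNorm δ) i fun i => v (some i) := by
  refine partialDeriv_eq_of_hasDerivAt
    ((contDiff_shiftedNorm hδ).differentiable (by norm_num) v) ?_
  rw [partialDeriv_smoothNorm hδ]
  have h := (hasDerivAt_smoothNorm_line hδ (fun i => v (some i)) i).add_const (v none)
  convert! h using 2 with t
  simp only [shiftedNorm]
  congr 2
  · funext j
    simp [Pi.single_apply]
  · simp

theorem partialDeriv_shiftedNorm_none {δ : ℝ} (hδ : 0 < δ) (v : Option I → ℝ) :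
    partialDeriv (shiftedNorm δ) none v = 1 := by
  refine partialDeriv_eq_of_hasDerivAt
    ((contDiff_shiftedNorm hδ).differentiable (by norm_num) v) ?_
  have h := ((hasDerivAt_id (0 : ℝ)).const_add (v none)).const_add
    (smoothNorm δ fun i => v (some i))
  convert! h using 2 with t
  simp only [shiftedNorm]
  congr 2
  · funext j
    simp
  · simp

theorem tameC1_comp_shiftedNorm {δ : ℝ} (hδ : 0 < δ) {T : ℝ → ℝ} (hT : ContDiff ℝ 1 T)
    (hT1 : ∀ r, |T r| ≤ 1) {K : ℝ} (hK : ∀ r, |deriv T r| ≤ K) :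
    TameC1 fun v : Option I → ℝ => T (shiftedNorm δ v) := by
  refine ⟨hT.comp (contDiff_shiftedNorm hδ), ?_, fun i => ?_⟩
  · obtain ⟨c, hc⟩ := UniformExpGrowth.of_bounded (Θ := Unit)
      (g := fun _ (v : Option I → ℝ) => T (shiftedNorm δ v)) fun _ v => hT1 _
    exact ⟨c, hc ()⟩
  · obtain ⟨c, hc⟩ := UniformExpGrowth.of_bounded (Θ := Unit) (K := K)
      (g := fun _ => partialDeriv (fun v : Option I → ℝ => T (shiftedNorm δ v)) i) fun _ v => by
        rw [partialDeriv_comp ((contDiff_shiftedNorm hδ).differentiable (by norm_num) v)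
          (hT.differentiable (by norm_num) _), abs_mul]
        have h1 : |partialDeriv (shiftedNorm δ) i v| ≤ 1 := by
          cases i with
          | none => simp [partialDeriv_shiftedNorm_none hδ]
          | some i =>
            rw [partialDeriv_shiftedNorm_some hδ, ← sq_le_one_iff_abs_le_one]
            exact (Finset.single_le_sum
              (f := fun i => partialDeriv (smoothNorm δ) i (fun i => v (some i)) ^ 2)
              (fun i _ => sq_nonneg _) (Finset.mem_univ i)).trans
              (sum_sq_partialDeriv_smoothNorm_le hδ _)
        exact (mul_le_mul (hK _) h1 (abs_nonneg _) ((abs_nonneg _).trans (hK 0))).trans_eq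
          (mul_one K)
    exact ⟨c, hc ()⟩

/-- The index set of a Gaussian matrix, a Gaussian scalar and two Gaussian vectors. -/
abbrev GordonIndex (I J : Type*) : Type _ := ((I × J) ⊕ Unit) ⊕ (I ⊕ J)

/-- The rows of the linear map `(M, γ, g, h) ↦ (M p, γ)`. -/
def gordonMatrixRow (p : J → ℝ) : Option I → GordonIndex I J → ℝ
  | some i => Sum.elim (Sum.elim (fun q => if q.1 = i then p q.2 else 0) 0) 0
  | none => Pi.single (Sum.inl (Sum.inr ())) 1

/-- The rows of the linear map `(M, γ, g, h) ↦ (g, -⟨h, p⟩)`. -/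
def gordonVectorRow (p : J → ℝ) : Option I → GordonIndex I J → ℝ
  | some i => Pi.single (Sum.inr (Sum.inl i)) 1
  | none => Sum.elim 0 (Sum.elim 0 (-p))

theorem gordonMatrixRow_some_dotProduct (p : J → ℝ) (i : I) (x : GordonIndex I J → ℝ) :
    gordonMatrixRow p (some i) ⬝ᵥ x = ∑ j, x (Sum.inl (Sum.inl (i, j))) * p j := by
  simp [gordonMatrixRow, dotProduct, Fintype.sum_prod_type, mul_comm]

theorem gordonMatrixRow_none_dotProduct (p : J → ℝ) (x : GordonIndex I J → ℝ) :
    gordonMatrixRow p none ⬝ᵥ x = x (Sum.inl (Sum.inr ())) := by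
  simp [gordonMatrixRow]

theorem gordonVectorRow_some_dotProduct (p : J → ℝ) (i : I) (x : GordonIndex I J → ℝ) :
    gordonVectorRow p (some i) ⬝ᵥ x = x (Sum.inr (Sum.inl i)) := by
  simp [gordonVectorRow]

theorem gordonVectorRow_none_dotProduct (p : J → ℝ) (x : GordonIndex I J → ℝ) :
    gordonVectorRow p (none : Option I) ⬝ᵥ x = -∑ j, x (Sum.inr (Sum.inr j)) * p j := by
  simp [gordonVectorRow, dotProduct, mul_comm]

theorem gordonMatrixRow_dotProduct_gordonVectorRow (p p' : J → ℝ) (i j : Option I) :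
    gordonMatrixRow p i ⬝ᵥ gordonVectorRow p' j = 0 := by
  cases i <;> cases j <;>
    simp [gordonVectorRow, gordonMatrixRow]

/-- These are covariances. For the matrix process they are `⟨p, p'⟩` on the vector coordinates and
`1` on the scalar one; for the vector process the two values are exchanged. Without the scalar `γ`
the covariances would not agree at unit `p = p'`, as the interpolation requires. -/
theorem gordonMatrixRow_dotProduct (p p' : J → ℝ) (i j : Option I) :
    gordonMatrixRow p i ⬝ᵥ gordonMatrixRow p' j
      = if i = j then (if i = none then 1 else p ⬝ᵥ p') else 0 := by
  cases i with
  | none => cases j <;> simp [gordonMatrixRow]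
  | some i =>
    rw [gordonMatrixRow_some_dotProduct]
    cases j with
    | none => simp [gordonMatrixRow]
    | some j => by_cases h : i = j <;> simp [gordonMatrixRow, h, dotProduct, mul_comm]

theorem gordonVectorRow_dotProduct (p p' : J → ℝ) (i j : Option I) :
    gordonVectorRow p i ⬝ᵥ gordonVectorRow p' j
      = if i = j then (if i = none then p ⬝ᵥ p' else 1) else 0 := by
  cases i <;> cases j <;>
    simp [gordonVectorRow, dotProduct, Pi.single_apply, mul_comm, eq_comm]

omit [DecidableEq J] in
theorem dotProduct_le_one_of_unit {p p' : J → ℝ} (hp : p ⬝ᵥ p = 1) (hp' : p' ⬝ᵥ p' = 1) :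
    p ⬝ᵥ p' ≤ 1 := by
  have h := dotProduct_self_nonneg_real (p - p')
  simp only [sub_dotProduct, dotProduct_sub, hp, hp', dotProduct_comm p' p] at h
  linarith

/-- Gordon's comparison of the processes `‖M p‖ + γ` and `‖g‖ - ⟨h, p⟩` on finite sets, for
products of increasing functions. -/
theorem gordon_integral_prod_le {Z : Type*} [Fintype Z] [DecidableEq Z] {p : Z → J → ℝ}
    (hp : ∀ z, p z ⬝ᵥ p z = 1) {δ : ℝ} (hδ : 0 < δ) {T : ℝ → ℝ} (hT : ContDiff ℝ 1 T)
    (hT0 : ∀ r, 0 ≤ T r) (hT1 : ∀ r, T r ≤ 1) (hTm : Monotone T) {K : ℝ}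
    (hK : ∀ r, |deriv T r| ≤ K) :
    ∫ x, ∏ z, T (shiftedNorm δ fun i => gordonVectorRow (p z) i ⬝ᵥ x) ∂gaussianPi (GordonIndex I J)
      ≤ ∫ x, ∏ z, T (shiftedNorm δ fun i => gordonMatrixRow (p z) i ⬝ᵥ x)
        ∂gaussianPi (GordonIndex I J) := by
  -- Here `C = 0`: the weighted sum equals `(1 - ⟨p z, p w⟩) T'(u) T'(v) (∑ ∂ᵢN(u) ∂ᵢN(v) - 1)` with
  -- `N` the smooth norm and `T'` evaluated at the shifted norms. The first three factors are
  -- nonnegative and the last is nonpositive, the gradients of `N` having length at most 1.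
  have key := integral_prod_le_of_partialDeriv_le (ι := GordonIndex I J) (C := 0)
    (tameC1_comp_shiftedNorm (I := I) hδ hT
      (fun r => abs_le.2 ⟨by linarith [hT0 r], hT1 r⟩) hK) (fun v => hT0 _)
    (fun z => gordonMatrixRow (p z)) (fun z => gordonVectorRow (p z))
    (fun z w i j => gordonMatrixRow_dotProduct_gordonVectorRow _ _ i j)
    (fun z i j => by
      rw [gordonMatrixRow_dotProduct, gordonVectorRow_dotProduct, hp])
    (fun z w _ u v => by
      have hd : ∀ v, DifferentiableAt ℝ (shiftedNorm (I := I) δ) v :=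
        (contDiff_shiftedNorm hδ).differentiable (by norm_num)
      have hTd := hT.differentiable (by norm_num)
      have hT' : ∀ r, 0 ≤ deriv T r := fun r => hTm.deriv_nonneg
      have h1 : ∀ i j : Option I, gordonVectorRow (p z) i ⬝ᵥ gordonVectorRow (p w) j
          - gordonMatrixRow (p z) i ⬝ᵥ gordonMatrixRow (p w) j
          = if i = j then (if i = none then -(1 - p z ⬝ᵥ p w) else 1 - p z ⬝ᵥ p w) else 0 := by
        intro i j
        rw [gordonMatrixRow_dotProduct, gordonVectorRow_dotProduct]
        split_ifs <;> ring
      simp only [h1, ite_mul, zero_mul, Finset.sum_ite_eq, Finset.mem_univ, if_true,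
        Fintype.sum_option, reduceCtorEq, if_false, partialDeriv_comp (hd _) (hTd _),
        partialDeriv_shiftedNorm_none hδ, partialDeriv_shiftedNorm_some hδ]
      have h2 := sum_partialDeriv_smoothNorm_mul_le hδ (fun i => u (some i)) fun i => v (some i)
      have h3 : 0 ≤ (1 - p z ⬝ᵥ p w) * (deriv T (shiftedNorm δ u) * deriv T (shiftedNorm δ v)) :=
        mul_nonneg (by linarith [dotProduct_le_one_of_unit (hp z) (hp w)])
          (mul_nonneg (hT' _) (hT' _))
      have h4 : ∑ i, (1 - p z ⬝ᵥ p w) * (deriv T (shiftedNorm δ u) *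
          partialDeriv (smoothNorm δ) i (fun i => u (some i)) * (deriv T (shiftedNorm δ v) *
            partialDeriv (smoothNorm δ) i fun i => v (some i)))
          = (1 - p z ⬝ᵥ p w) * (deriv T (shiftedNorm δ u) * deriv T (shiftedNorm δ v)) *
            ∑ i, partialDeriv (smoothNorm δ) i (fun i => u (some i)) *
              partialDeriv (smoothNorm δ) i fun i => v (some i) := by
        rw [Finset.mul_sum]
        exact Finset.sum_congr rfl fun i _ => by ring
      rw [h4]
      nlinarith [mul_le_mul_of_nonneg_left h2 h3])
  simpa using key

end Gordon

/-! ### From integrals to tails and exponential moments in Gordon's comparison. -/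

theorem exists_abs_deriv_smoothTransition_le :
    ∃ K, ∀ r, |deriv Real.smoothTransition r| ≤ K := by
  have hc : ContDiff ℝ 1 Real.smoothTransition := Real.smoothTransition.contDiff (n := 1)
  refine (hc.continuous_deriv le_rfl).bounded_above_of_compact_support
    (HasCompactSupport.intro (isCompact_Icc (a := (0 : ℝ)) (b := 1)) fun r hr => ?_)
  rw [Set.mem_Icc, not_and_or, not_le, not_le] at hr
  rcases hr with hr | hr
  · have h : Real.smoothTransition =ᶠ[nhds r] fun _ => 0 := by
      filter_upwards [gt_mem_nhds hr] with s hs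
      exact Real.smoothTransition.zero_of_nonpos hs.le
    rw [h.deriv_eq, deriv_const]
  · have h : Real.smoothTransition =ᶠ[nhds r] fun _ => 1 := by
      filter_upwards [lt_mem_nhds hr] with s hs
      exact Real.smoothTransition.one_of_one_le hs.le
    rw [h.deriv_eq, deriv_const]

/-- Layer-cake formula; it turns a comparison of tails into one of expectations. -/
theorem integral_le_integral_of_measure_superlevel_le {α : Type*} [MeasurableSpace α]
    {μ : Measure α} {U V : α → ℝ} (hU : 0 ≤ U) (hV : 0 ≤ V) (hUm : AEStronglyMeasurable U μ)
    (hVi : Integrable V μ) (h : ∀ s > 0, μ {x | s ≤ U x} ≤ μ {x | s ≤ V x}) :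
    ∫ x, U x ∂μ ≤ ∫ x, V x ∂μ := by
  rw [integral_eq_lintegral_of_nonneg_ae (Filter.Eventually.of_forall hU) hUm,
    integral_eq_lintegral_of_nonneg_ae (Filter.Eventually.of_forall hV) hVi.1]
  refine ENNReal.toReal_mono hVi.lintegral_lt_top.ne ?_
  rw [lintegral_eq_lintegral_meas_le μ (Filter.Eventually.of_forall hU) hUm.aemeasurable,
    lintegral_eq_lintegral_meas_le μ (Filter.Eventually.of_forall hV) hVi.1.aemeasurable]
  exact setLIntegral_mono' measurableSet_Ioi fun s hs => h s hs

theorem integral_mul_gaussianPi_sum {α β : Type*} [Fintype α] [Fintype β] (f : (α → ℝ) → ℝ)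
    (g : (β → ℝ) → ℝ) :
    ∫ x : α ⊕ β → ℝ, f (fun i => x (Sum.inl i)) * g (fun i => x (Sum.inr i)) ∂gaussianPi (α ⊕ β)
      = (∫ x, f x ∂gaussianPi α) * ∫ x, g x ∂gaussianPi β := by
  have h := (measurePreserving_sumPiEquivProdPi (X := fun _ : α ⊕ β => ℝ)
    (fun _ => gaussianReal 0 1)).integral_comp' (fun y => f y.1 * g y.2)
  rw [integral_prod_mul] at h
  exact h

section Gordon

variable {I J Z : Type*} [Fintype I] [DecidableEq I] [Fintype J] [DecidableEq J] [Fintype Z]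
  [DecidableEq Z]

omit [DecidableEq I] [DecidableEq J] [Fintype Z] [DecidableEq Z] in
theorem continuous_shiftedNorm_rows {δ : ℝ} (hδ : 0 < δ)
    (r : (J → ℝ) → Option I → GordonIndex I J → ℝ) (p : Z → J → ℝ) (z : Z) :
    Continuous fun x => shiftedNorm δ fun i => r (p z) i ⬝ᵥ x := by
  refine (contDiff_shiftedNorm hδ).continuous.comp (continuous_pi fun i => ?_)
  simp only [dotProduct]
  fun_prop

/-- Gordon's comparison of the lower tails of `min (‖M p‖ + γ)` and `min (‖g‖ - ⟨h, p⟩)`. -/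
theorem gordon_measure_le {p : Z → J → ℝ} (hp : ∀ z, p z ⬝ᵥ p z = 1) {δ κ : ℝ} (hδ : 0 < δ)
    (hκ : 0 < κ) (t : ℝ) :
    gaussianPi (GordonIndex I J)
        {x | ∃ z, shiftedNorm δ (fun i : Option I => gordonMatrixRow (p z) i ⬝ᵥ x) ≤ t}
      ≤ gaussianPi (GordonIndex I J)
        {x | ∃ z, shiftedNorm δ (fun i : Option I => gordonVectorRow (p z) i ⬝ᵥ x) ≤ t + κ} := by
  obtain ⟨K, hK⟩ := exists_abs_deriv_smoothTransition_le
  -- A smooth step, `0` up to `t` and `1` from `t + κ` on. Hence `1 - ∏ T` lies above the indicator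
  -- of "some value is at most `t`" and below that of "some value is at most `t + κ`".
  set T : ℝ → ℝ := fun r => Real.smoothTransition ((r - t) / κ) with hT
  have hlin : ∀ r, HasDerivAt (fun r : ℝ => (r - t) / κ) (1 / κ) r := fun r =>
    ((hasDerivAt_id r).sub_const t).div_const κ
  have hsm : ContDiff ℝ 1 Real.smoothTransition := Real.smoothTransition.contDiff (n := 1)
  have hTc : ContDiff ℝ 1 T := hsm.comp (by fun_prop)
  have hTd : ∀ r, |deriv T r| ≤ K * |1 / κ| := fun r => by
    have h := ((hsm.differentiable (by norm_num) ((r - t) / κ)).hasDerivAt.comp r (hlin r)).deriv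
    have h' : deriv T r = deriv Real.smoothTransition ((r - t) / κ) * (1 / κ) := h
    rw [h', abs_mul]
    exact mul_le_mul_of_nonneg_right (hK _) (abs_nonneg _)
  have hTm : Monotone T := fun r s hrs => Real.smoothTransition.monotone (by gcongr)
  have hT0 : ∀ r, 0 ≤ T r := fun r => Real.smoothTransition.nonneg _
  have hT1 : ∀ r, T r ≤ 1 := fun r => Real.smoothTransition.le_one _
  have key := gordon_integral_prod_le (I := I) hp hδ hTc hT0 hT1 hTm hTd
  set X : Z → (GordonIndex I J → ℝ) → ℝ := fun z x =>
    shiftedNorm δ fun i : Option I => gordonMatrixRow (p z) i ⬝ᵥ x with hX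
  set Y : Z → (GordonIndex I J → ℝ) → ℝ := fun z x =>
    shiftedNorm δ fun i : Option I => gordonVectorRow (p z) i ⬝ᵥ x with hY
  have cX : ∀ z, Continuous (X z) := continuous_shiftedNorm_rows hδ gordonMatrixRow p
  have cY : ∀ z, Continuous (Y z) := continuous_shiftedNorm_rows hδ gordonVectorRow p
  have mX : ∀ s, MeasurableSet {x | ∃ z, X z x ≤ s} := fun s => by
    simp only [Set.ofPred_exists]
    exact MeasurableSet.iUnion fun z => measurableSet_le (cX z).measurable measurable_const
  have mY : ∀ s, MeasurableSet {x | ∃ z, Y z x ≤ s} := fun s => by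
    simp only [Set.ofPred_exists]
    exact MeasurableSet.iUnion fun z => measurableSet_le (cY z).measurable measurable_const
  have hint : ∀ V : Z → (GordonIndex I J → ℝ) → ℝ, (∀ z, Continuous (V z)) →
      Integrable (fun x => ∏ z, T (V z x)) (gaussianPi (GordonIndex I J)) := fun V hV =>
    Integrable.of_bound (C := 1) (continuous_finsetProd _ fun z _ =>
      hTc.continuous.comp (hV z)).aestronglyMeasurable (Filter.Eventually.of_forall fun x => by
        rw [Real.norm_eq_abs, abs_of_nonneg (Finset.prod_nonneg fun z _ => hT0 _)]
        exact Finset.prod_le_one (fun z _ => hT0 _) fun z _ => hT1 _)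
  have hl : (gaussianPi (GordonIndex I J)).real {x | ∃ z, X z x ≤ t}
      ≤ 1 - ∫ x, ∏ z, T (X z x) ∂gaussianPi (GordonIndex I J) := by
    rw [← integral_indicator_one (mX t), ← probReal_univ (μ := gaussianPi (GordonIndex I J)),
      ← setIntegral_one_eq_measureReal, setIntegral_univ, ← integral_sub (by simp) (hint X cX)]
    refine integral_mono ((integrable_const (1 : ℝ)).indicator (mX t))
      ((integrable_const _).sub (hint X cX)) fun x => ?_
    by_cases hx : x ∈ {x | ∃ z, X z x ≤ t}
    · rw [Set.indicator_of_mem hx]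
      obtain ⟨z, hz⟩ := hx
      have : ∏ z, T (X z x) = 0 := Finset.prod_eq_zero (Finset.mem_univ z)
        (Real.smoothTransition.zero_of_nonpos (div_nonpos_of_nonpos_of_nonneg
          (by linarith) hκ.le))
      simp [this]
    · rw [Set.indicator_of_notMem hx]
      exact sub_nonneg.2 (Finset.prod_le_one (fun z _ => hT0 _) fun z _ => hT1 _)
  have hr : 1 - ∫ x, ∏ z, T (Y z x) ∂gaussianPi (GordonIndex I J)
      ≤ (gaussianPi (GordonIndex I J)).real {x | ∃ z, Y z x ≤ t + κ} := by
    rw [← integral_indicator_one (mY _), ← probReal_univ (μ := gaussianPi (GordonIndex I J)),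
      ← setIntegral_one_eq_measureReal, setIntegral_univ, ← integral_sub (by simp) (hint Y cY)]
    refine integral_mono ((integrable_const _).sub (hint Y cY))
      ((integrable_const (1 : ℝ)).indicator (mY _)) fun x => ?_
    by_cases hx : x ∈ {x | ∃ z, Y z x ≤ t + κ}
    · rw [Set.indicator_of_mem hx]
      have := Finset.prod_nonneg fun z (_ : z ∈ Finset.univ) => hT0 (Y z x)
      simpa using this
    · rw [Set.indicator_of_notMem hx]
      simp only [Set.mem_ofPred_eq, not_exists, not_le] at hx
      have : ∏ z, T (Y z x) = 1 := Finset.prod_eq_one fun z _ =>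
        Real.smoothTransition.one_of_one_le ((one_le_div hκ).2 (by linarith [hx z]))
      simp [this]
  have hfin : (gaussianPi (GordonIndex I J)).real {x | ∃ z, X z x ≤ t}
      ≤ (gaussianPi (GordonIndex I J)).real {x | ∃ z, Y z x ≤ t + κ} := by linarith
  exact (ENNReal.toReal_le_toReal (measure_ne_top _ _) (measure_ne_top _ _)).1 hfin

theorem norm_comp_le_norm {α ι : Type*} [Fintype α] [Fintype ι] (e : α → ι) (x : ι → ℝ) :
    ‖fun i => x (e i)‖ ≤ ‖x‖ :=
  (pi_norm_le_iff_of_nonneg (norm_nonneg x)).2 fun i => norm_le_pi_norm x (e i)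

theorem integral_exp_mul_gaussianPi_unit (c : ℝ) :
    ∫ x : Unit → ℝ, Real.exp (c * x ()) ∂gaussianPi Unit = Real.exp (c ^ 2 / 2) := by
  rw [integral_comp_eval (μ := fun _ : Unit => gaussianReal 0 1) (i := ())
    (f := fun t => Real.exp (c * t)) (by fun_prop)]
  have h := congrFun (mgf_fun_id_gaussianReal (μ := 0) (v := 1)) c
  simpa [mgf] using h

/-- Gordon's comparison for exponential moments: a lower tail bound for `min ‖M p‖` in terms of
Gaussian vectors `g` and `h`, where `S` dominates the linear forms given by the points `p`. -/
theorem gordon_tail_le [Nonempty Z] {p : Z → J → ℝ} (hp : ∀ z, p z ⬝ᵥ p z = 1) {δ κ lam : ℝ}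
    (hδ : 0 < δ) (hκ : 0 < κ) (hlam : 0 < lam) (τ : ℝ) {S : (J → ℝ) → ℝ} (hS : Continuous S)
    (hpS : ∀ z h, p z ⬝ᵥ h ≤ S h) {c : ℝ}
    (hSc : ∀ h, |Real.exp (lam * S h)| ≤ Real.exp (c * (1 + ‖h‖))) :
    Real.exp (-lam * (τ + δ)) * Real.exp (lam ^ 2 / 2) *
        (gaussianPi (I × J)).real {M | ∃ z, Real.sqrt ((fun i => ∑ j, M (i, j) * p z j) ⬝ᵥ
          fun i => ∑ j, M (i, j) * p z j) < τ}
      ≤ Real.exp (lam * κ) * ((∫ g : I → ℝ, Real.exp (-lam * smoothNorm δ g) ∂gaussianPi I) *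
        ∫ h, Real.exp (lam * S h) ∂gaussianPi J) := by
  set X : Z → (GordonIndex I J → ℝ) → ℝ := fun z x =>
    shiftedNorm δ fun i : Option I => gordonMatrixRow (p z) i ⬝ᵥ x with hX
  set Y : Z → (GordonIndex I J → ℝ) → ℝ := fun z x =>
    shiftedNorm δ fun i : Option I => gordonVectorRow (p z) i ⬝ᵥ x with hY
  have cX : ∀ z, Continuous (X z) := continuous_shiftedNorm_rows hδ gordonMatrixRow p
  have hXe : ∀ z x, X z x = smoothNorm δ (fun i => ∑ j, x (Sum.inl (Sum.inl (i, j))) * p z j)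
      + x (Sum.inl (Sum.inr ())) := fun z x => by
    simp only [hX, shiftedNorm, gordonMatrixRow_some_dotProduct, gordonMatrixRow_none_dotProduct]
  have hYe : ∀ z x, Y z x = smoothNorm δ (fun i => x (Sum.inr (Sum.inl i)))
      - p z ⬝ᵥ fun j => x (Sum.inr (Sum.inr j)) := fun z x => by
    simp only [hY, shiftedNorm, gordonVectorRow_some_dotProduct, gordonVectorRow_none_dotProduct]
    simp only [dotProduct, mul_comm, sub_eq_add_neg]
  set B : Set (I × J → ℝ) := {M | ∃ z, Real.sqrt ((fun i => ∑ j, M (i, j) * p z j) ⬝ᵥ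
          fun i => ∑ j, M (i, j) * p z j) < τ} with hB
  have mB : MeasurableSet B := by
    simp only [hB, Set.ofPred_exists]
    refine MeasurableSet.iUnion fun z => measurableSet_lt ?_ measurable_const
    simp only [dotProduct]
    fun_prop
  -- `U` is `exp (-lam * min X)`, so its superlevel sets are exactly the lower-tail events of
  -- Gordon's comparison. `V` dominates `exp (-lam * (min Y - κ))`, because `S` dominates every `⟨p
  -- z, h⟩`.
  set U : (GordonIndex I J → ℝ) → ℝ := fun x =>
    Finset.univ.sup' Finset.univ_nonempty fun z : Z => Real.exp (-lam * X z x) with hU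
  set V : (GordonIndex I J → ℝ) → ℝ := fun x => Real.exp (lam * κ) *
    (Real.exp (-lam * smoothNorm δ fun i => x (Sum.inr (Sum.inl i))) *
      Real.exp (lam * S fun j => x (Sum.inr (Sum.inr j)))) with hV
  have hU0 : 0 ≤ U := fun x => by
    obtain ⟨z⟩ := ‹Nonempty Z›
    exact (Real.exp_pos _).le.trans
      (Finset.le_sup' (fun z : Z => Real.exp (-lam * X z x)) (Finset.mem_univ z))
  have cU : Continuous U := Continuous.finset_sup'_apply _ fun z _ => by
    have := cX z
    fun_prop
  have cV : Continuous V := by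
    have := (contDiff_smoothNorm (k := I) hδ).continuous
    simp only [hV]
    fun_prop
  have iU : Integrable U (gaussianPi _) := by
    refine integrable_gaussianPi_of_le_exp cU (c := lam) fun x => ?_
    rw [abs_of_nonneg (hU0 x)]
    refine Finset.sup'_le _ _ fun z _ => Real.exp_le_exp.2 ?_
    have h1 := (smoothNorm_pos hδ (fun i => ∑ j, x (Sum.inl (Sum.inl (i, j))) * p z j)).le
    have h2 := norm_le_pi_norm x (Sum.inl (Sum.inr ()))
    rw [Real.norm_eq_abs] at h2
    rw [neg_mul, ← mul_neg]
    refine mul_le_mul_of_nonneg_left ?_ hlam.le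
    rw [hXe]
    linarith [neg_abs_le (x (Sum.inl (Sum.inr ())))]
  have iV : Integrable V (gaussianPi _) := by
    refine (integrable_gaussianPi_of_le_exp (c := |c|) (by
      have := (contDiff_smoothNorm (k := I) hδ).continuous
      fun_prop) fun x => ?_).const_mul _
    rw [abs_mul]
    refine (mul_le_of_le_one_left (abs_nonneg _) ?_).trans ((hSc _).trans ?_)
    · rw [Real.abs_exp, Real.exp_le_one_iff]
      nlinarith [smoothNorm_pos hδ fun i => x (Sum.inr (Sum.inl i))]
    · refine Real.exp_le_exp.2 ?_
      have h1 := norm_comp_le_norm (fun j : J => (Sum.inr (Sum.inr j) : GordonIndex I J)) x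
      have h2 := norm_nonneg fun j : J => x (Sum.inr (Sum.inr j))
      calc c * (1 + ‖fun j : J => x (Sum.inr (Sum.inr j))‖)
          ≤ |c| * (1 + ‖fun j : J => x (Sum.inr (Sum.inr j))‖) := by gcongr; exact le_abs_self c
        _ ≤ _ := by gcongr
  have hUV : ∫ x, U x ∂gaussianPi (GordonIndex I J) ≤ ∫ x, V x ∂gaussianPi (GordonIndex I J) := by
    refine integral_le_integral_of_measure_superlevel_le hU0 (fun x => by positivity)
      cU.aestronglyMeasurable iV fun s hs => ?_
    have hsup : {x | s ≤ U x} = {x | ∃ z, X z x ≤ -Real.log s / lam} := by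
      ext x
      simp only [Set.mem_ofPred_eq, hU, Finset.le_sup'_iff, Finset.mem_univ, true_and]
      refine exists_congr fun z => ?_
      rw [← Real.log_le_iff_le_exp hs, le_div_iff₀ hlam]
      constructor <;> intro h <;> linarith
    rw [hsup]
    refine (gordon_measure_le hp hδ hκ _).trans (measure_mono ?_)
    rintro x ⟨z, hz⟩
    have hz' : Y z x ≤ -Real.log s / lam + κ := hz
    rw [hYe] at hz'
    have h1 := hpS z fun j => x (Sum.inr (Sum.inr j))
    simp only [Set.mem_ofPred_eq, hV, ← Real.exp_add]
    rw [← Real.log_le_iff_le_exp hs]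
    have h2 := mul_le_mul_of_nonneg_left hz' hlam.le
    have h3 := mul_le_mul_of_nonneg_left h1 hlam.le
    rw [mul_add, mul_div_cancel₀ _ hlam.ne'] at h2
    linarith
  have eV : ∫ x, V x ∂gaussianPi (GordonIndex I J) = Real.exp (lam * κ) *
      ((∫ g : I → ℝ, Real.exp (-lam * smoothNorm δ g) ∂gaussianPi I) *
        ∫ h, Real.exp (lam * S h) ∂gaussianPi J) := by
    have h1 := integral_mul_gaussianPi_sum (α := (I × J) ⊕ Unit) (β := I ⊕ J) (fun _ => 1)
      fun y => Real.exp (-lam * smoothNorm δ fun i => y (Sum.inl i)) *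
        Real.exp (lam * S fun j => y (Sum.inr j))
    rw [integral_mul_gaussianPi_sum (fun g => Real.exp (-lam * smoothNorm δ g))
      fun h => Real.exp (lam * S h)] at h1
    simp only [one_mul, integral_const, probReal_univ, smul_eq_mul] at h1
    rw [hV, integral_const_mul, h1]
  -- The scalar `γ` is independent of the matrix, so its Laplace transform `e^{lam²/2}` splits off
  -- next to the probability of `B`.
  have eB : ∫ x : GordonIndex I J → ℝ, Real.exp (-lam * (τ + δ)) *
      (B.indicator 1 (fun q => x (Sum.inl (Sum.inl q))) *
        Real.exp (-lam * x (Sum.inl (Sum.inr ())))) ∂gaussianPi _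
      = Real.exp (-lam * (τ + δ)) * Real.exp (lam ^ 2 / 2) * (gaussianPi (I × J)).real B := by
    have h1 := integral_mul_gaussianPi_sum (α := (I × J) ⊕ Unit) (β := I ⊕ J)
      (fun y => B.indicator 1 (fun q => y (Sum.inl q)) * Real.exp (-lam * y (Sum.inr ())))
      fun _ => 1
    rw [integral_mul_gaussianPi_sum (B.indicator 1) fun y : Unit → ℝ => Real.exp (-lam * y ()),
      integral_indicator_one mB, integral_exp_mul_gaussianPi_unit, neg_sq] at h1
    simp only [mul_one, integral_const, probReal_univ, smul_eq_mul] at h1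
    rw [integral_const_mul, h1]
    ring
  rw [← eB, ← eV]
  refine le_trans (integral_mono_of_nonneg (Filter.Eventually.of_forall fun x => ?_) iU
    (Filter.Eventually.of_forall fun x => ?_)) hUV
  · exact mul_nonneg (Real.exp_pos _).le (mul_nonneg
      (Set.indicator_nonneg (fun _ _ => zero_le_one) _) (Real.exp_pos _).le)
  · simp only
    by_cases hx : (fun q => x (Sum.inl (Sum.inl q))) ∈ B
    · rw [Set.indicator_of_mem hx, Pi.one_apply, one_mul, ← Real.exp_add]
      obtain ⟨z, hz⟩ := hx
      refine le_trans (Real.exp_le_exp.2 ?_)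
        (Finset.le_sup' (fun z : Z => Real.exp (-lam * X z x)) (Finset.mem_univ z))
      -- On `B` some `z` has smooth norm below `τ + δ`, hence `X z x < τ + δ + γ`.
      have h1 := smoothNorm_le hδ.le (fun i => ∑ j, x (Sum.inl (Sum.inl (i, j))) * p z j)
      rw [hXe]
      nlinarith
    · rw [Set.indicator_of_notMem hx, zero_mul, mul_zero]
      exact hU0 x

end Gordon

/-! ### A smooth maximum of linear forms. -/

section Softmax

variable {J Z : Type*} [Fintype J] [Fintype Z]

/-- The log-sum-exp approximation of `max_z ⟨p z, h⟩`. -/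
noncomputable def softmax (α : ℝ) (p : Z → J → ℝ) (h : J → ℝ) : ℝ :=
  α⁻¹ * Real.log (∑ z, Real.exp (α * (p z ⬝ᵥ h)))

variable {α : ℝ} {p : Z → J → ℝ}

theorem sum_exp_dotProduct_pos [Nonempty Z] (α : ℝ) (p : Z → J → ℝ) (h : J → ℝ) :
    0 < ∑ z, Real.exp (α * (p z ⬝ᵥ h)) :=
  Finset.sum_pos (fun _ _ => Real.exp_pos _) Finset.univ_nonempty

theorem dotProduct_le_softmax (hα : 0 < α) (z : Z) (h : J → ℝ) : p z ⬝ᵥ h ≤ softmax α p h := by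
  rw [softmax, inv_mul_eq_div, le_div_iff₀ hα, mul_comm, ← Real.log_exp (α * (p z ⬝ᵥ h))]
  exact Real.log_le_log (Real.exp_pos _) (Finset.single_le_sum
    (f := fun z => Real.exp (α * (p z ⬝ᵥ h))) (fun _ _ => (Real.exp_pos _).le) (Finset.mem_univ z))

theorem softmax_le [Nonempty Z] (hα : 0 < α) {h : J → ℝ} {r : ℝ} (hr : ∀ z, p z ⬝ᵥ h ≤ r) :
    softmax α p h ≤ r + Real.log (Fintype.card Z) / α := by
  have h1 : ∑ z, Real.exp (α * (p z ⬝ᵥ h)) ≤ Fintype.card Z * Real.exp (α * r) := by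
    refine (Finset.sum_le_card_nsmul _ _ (Real.exp (α * r)) fun z _ => ?_).trans_eq (by simp)
    have := hr z
    gcongr
  have h2 := Real.log_le_log (sum_exp_dotProduct_pos α p h) h1
  rw [Real.log_mul (by simp) (Real.exp_ne_zero _), Real.log_exp] at h2
  rw [softmax, inv_mul_eq_div, div_le_iff₀ hα, add_mul, div_mul_cancel₀ _ hα.ne']
  linarith

theorem contDiff_softmax [Nonempty Z] : ContDiff ℝ 1 (softmax α p) := by
  unfold softmax
  refine contDiff_const.mul (ContDiff.log ?_ fun h => (sum_exp_dotProduct_pos α p h).ne')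
  simp only [dotProduct]
  fun_prop

theorem partialDeriv_softmax [DecidableEq J] [Nonempty Z] (hα : 0 < α) (i : J) (h : J → ℝ) :
    partialDeriv (softmax α p) i h
      = ∑ z, (Real.exp (α * (p z ⬝ᵥ h)) / ∑ z, Real.exp (α * (p z ⬝ᵥ h))) * p z i := by
  refine partialDeriv_eq_of_hasDerivAt (contDiff_softmax.differentiable (by norm_num) h) ?_
  have h1 : ∀ z, HasDerivAt
      (fun t : ℝ => Real.exp (α * (p z ⬝ᵥ (h + t • (Pi.single i 1 : J → ℝ)))))
      (Real.exp (α * (p z ⬝ᵥ h)) * (α * p z i)) 0 := fun z => by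
    simp only [dotProduct_add, dotProduct_smul, dotProduct_single, mul_one, smul_eq_mul]
    simpa using ((((hasDerivAt_id (0 : ℝ)).mul_const (p z i)).const_add (p z ⬝ᵥ h)).const_mul α).exp
  have h2 := ((HasDerivAt.fun_sum (u := Finset.univ) fun z _ => h1 z).log
    (by simpa using (sum_exp_dotProduct_pos α p h).ne')).const_mul α⁻¹
  convert! h2 using 1
  simp only [zero_smul, add_zero]
  rw [Finset.sum_div, Finset.mul_sum]
  refine Finset.sum_congr rfl fun z _ => ?_
  field_simp

/-- The gradient is a convex combination of the unit vectors `p z`, with Gibbs weights; Jensen's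
inequality for the square bounds its length. -/
theorem sum_sq_partialDeriv_softmax_le [DecidableEq J] [Nonempty Z] (hα : 0 < α)
    (hp : ∀ z, p z ⬝ᵥ p z = 1) (h : J → ℝ) : ∑ i, partialDeriv (softmax α p) i h ^ 2 ≤ 1 := by
  simp only [partialDeriv_softmax hα]
  have hpos := sum_exp_dotProduct_pos α p h
  set w : Z → ℝ := fun z => Real.exp (α * (p z ⬝ᵥ h)) / ∑ z, Real.exp (α * (p z ⬝ᵥ h)) with hw
  have hw0 : ∀ z, 0 ≤ w z := fun z => div_nonneg (Real.exp_pos _).le hpos.le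
  have hw1 : ∑ z, w z = 1 := by rw [hw, ← Finset.sum_div, div_self hpos.ne']
  calc ∑ i, (∑ z, w z * p z i) ^ 2 ≤ ∑ i, ∑ z, w z * p z i ^ 2 :=
        Finset.sum_le_sum fun i _ => by
          simpa using (even_two.convexOn_pow (𝕜 := ℝ)).map_sum_le (t := Finset.univ) (w := w)
            (p := fun z => p z i) (fun z _ => hw0 z) hw1 (fun z _ => trivial)
    _ = ∑ z, w z * (p z ⬝ᵥ p z) := by
        rw [Finset.sum_comm]
        simp only [dotProduct, Finset.mul_sum, sq]
    _ = 1 := by simp [hp, hw1]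

end Softmax

/-! ### Gaussian moments and the mean norm. -/

section Moments

variable {k : Type*} [Fintype k] [DecidableEq k]

omit [DecidableEq k] in
theorem growth_coordinate (i : k) : UniformExpGrowth fun (_ : Unit) (x : k → ℝ) => x i := by
  refine ⟨1, fun _ x => ?_⟩
  have h1 := Real.add_one_le_exp (1 * (1 + ‖x‖))
  have h2 := norm_le_pi_norm x i
  rw [Real.norm_eq_abs] at h2
  linarith

theorem growth_smoothNorm {δ : ℝ} (hδ : 0 < δ) :
    UniformExpGrowth fun (_ : Unit) (x : k → ℝ) => smoothNorm δ x := by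
  obtain ⟨c, hc⟩ := exists_abs_le_of_sum_sq_partialDeriv_le (contDiff_smoothNorm (k := k) hδ)
    (sum_sq_partialDeriv_smoothNorm_le hδ)
  exact ⟨c, fun _ v => (hc v).trans (by linarith [Real.add_one_le_exp (c * (1 + ‖v‖))])⟩

omit [DecidableEq k] in
theorem UniformExpGrowth.integrable {f : (k → ℝ) → ℝ}
    (hf : UniformExpGrowth fun (_ : Unit) x => f x) (hc : Continuous f) :
    Integrable f (gaussianPi k) := by
  obtain ⟨c, h⟩ := hf
  exact integrable_gaussianPi_of_le_exp hc (h ())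

theorem integral_coordinate_mul {G G' : (k → ℝ) → ℝ} (i : k) (hG : Continuous G)
    (hG' : Continuous G')
    (hd : ∀ x, HasDerivAt (fun t : ℝ => G (x + t • (Pi.single i 1 : k → ℝ))) (G' x) 0)
    (hg : UniformExpGrowth fun (_ : Unit) x => G x)
    (hg' : UniformExpGrowth fun (_ : Unit) x => G' x) :
    ∫ x, x i * G x ∂gaussianPi k = ∫ x, G' x ∂gaussianPi k := by
  obtain ⟨c, hc⟩ := hg
  obtain ⟨c', hc'⟩ := hg'
  have h := integral_dotProduct_mul_gaussianPi (Pi.single i 1) hG hG' hd (c := max c c')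
    (fun x => (hc () x).trans (by have := norm_nonneg x; gcongr; exact le_max_left _ _))
    (fun x => (hc' () x).trans (by have := norm_nonneg x; gcongr; exact le_max_right _ _))
  simpa using h

omit [Fintype k] in
theorem hasDerivAt_coordinate_line (x : k → ℝ) (i : k) :
    HasDerivAt (fun t : ℝ => (x + t • (Pi.single i 1 : k → ℝ)) i) 1 0 := by
  simpa using (hasDerivAt_id (0 : ℝ)).const_add (x i)

theorem integral_coordinate (i : k) : ∫ x, x i ∂gaussianPi k = 0 := by
  have h := integral_coordinate_mul (k := k) (G := fun _ => 1) (G' := fun _ => 0) i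
    continuous_const continuous_const (fun x => hasDerivAt_const _ _)
    (UniformExpGrowth.of_bounded (K := 1) (by simp)) (UniformExpGrowth.of_bounded (K := 0) (by simp))
  simpa using h

theorem integral_coordinate_mul_self (i : k) : ∫ x, x i * x i ∂gaussianPi k = 1 := by
  have h := integral_coordinate_mul (k := k) (G := fun x => x i) (G' := fun _ => 1) i
    (by fun_prop) continuous_const (fun x => hasDerivAt_coordinate_line x i) (growth_coordinate i)
    (UniformExpGrowth.of_bounded (K := 1) (by simp))
  simpa using h

omit [DecidableEq k] in
theorem integrable_coordinate (i : k) : Integrable (fun x : k → ℝ => x i) (gaussianPi k) :=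
  (growth_coordinate i).integrable (by fun_prop)

omit [DecidableEq k] in
theorem integrable_coordinate_mul_self (i : k) :
    Integrable (fun x : k → ℝ => x i * x i) (gaussianPi k) :=
  ((growth_coordinate i).mul (growth_coordinate i)).integrable (by fun_prop)

omit [DecidableEq k] in
theorem integrable_dotProduct_self : Integrable (fun x : k → ℝ => x ⬝ᵥ x) (gaussianPi k) :=
  integrable_finsetSum _ fun i _ => integrable_coordinate_mul_self i

theorem integral_dotProduct_self : ∫ x : k → ℝ, x ⬝ᵥ x ∂gaussianPi k = Fintype.card k := by
  simp only [dotProduct]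
  rw [integral_finsetSum _ fun i _ => integrable_coordinate_mul_self i]
  simp [integral_coordinate_mul_self]

omit [DecidableEq k] in
theorem integrable_dotProduct (c : k → ℝ) :
    Integrable (fun x : k → ℝ => c ⬝ᵥ x) (gaussianPi k) :=
  integrable_finsetSum _ fun i _ => (integrable_coordinate i).const_mul _

theorem integral_dotProduct (c : k → ℝ) : ∫ x : k → ℝ, c ⬝ᵥ x ∂gaussianPi k = 0 := by
  simp only [dotProduct]
  rw [integral_finsetSum _ fun i _ => (integrable_coordinate i).const_mul _]
  simp [integral_const_mul, integral_coordinate]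

/-- With `N` the smooth norm and `n = Fintype.card k`, integration by parts in each coordinate gives
`𝔼 xᵢ² N = 𝔼 (N + xᵢ² / N)`. The sum over `i` is `𝔼 (n N + ‖x‖² / N)`, and `‖x‖² ≤ N²`. -/
theorem integral_dotProduct_self_mul_smoothNorm_le {δ : ℝ} (hδ : 0 < δ) :
    Integrable (fun x : k → ℝ => (x ⬝ᵥ x) * smoothNorm δ x) (gaussianPi k) ∧
    ∫ x : k → ℝ, (x ⬝ᵥ x) * smoothNorm δ x ∂gaussianPi k
      ≤ (Fintype.card k + 1) * ∫ x : k → ℝ, smoothNorm δ x ∂gaussianPi k := by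
  have cN : Continuous (smoothNorm (k := k) δ) := (contDiff_smoothNorm hδ).continuous
  have gN := growth_smoothNorm (k := k) hδ
  have iN : Integrable (smoothNorm (k := k) δ) (gaussianPi k) := gN.integrable cN
  have hN := smoothNorm_pos (k := k) hδ
  have cd : ∀ i : k, Continuous fun x : k → ℝ => x i / smoothNorm δ x := fun i =>
    (continuous_apply i).div cN fun x => (hN x).ne'
  have gd : ∀ i : k, UniformExpGrowth fun (_ : Unit) (x : k → ℝ) => x i / smoothNorm δ x :=
    fun i => UniformExpGrowth.of_bounded (K := 1) fun _ x => by
      rw [← partialDeriv_smoothNorm hδ, ← sq_le_one_iff_abs_le_one]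
      exact (Finset.single_le_sum (f := fun i => partialDeriv (smoothNorm δ) i x ^ 2)
        (fun i _ => sq_nonneg _) (Finset.mem_univ i)).trans
        (sum_sq_partialDeriv_smoothNorm_le hδ x)
  have iG : ∀ i : k, Integrable (fun x : k → ℝ => x i * (x i * smoothNorm δ x)) (gaussianPi k) :=
    fun i => ((growth_coordinate i).mul ((growth_coordinate i).mul gN)).integrable (by fun_prop)
  have gG' : ∀ i : k, UniformExpGrowth fun (_ : Unit) (x : k → ℝ) =>
      1 * smoothNorm δ x + x i * (x i / smoothNorm δ x) := fun i =>
    ((UniformExpGrowth.of_bounded (K := 1) (by simp)).mul gN).add ((growth_coordinate i).mul (gd i))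
  have cG' : ∀ i : k, Continuous fun x : k → ℝ =>
      1 * smoothNorm δ x + x i * (x i / smoothNorm δ x) := fun i => by
    have := cd i
    fun_prop
  have hst : ∀ i : k, ∫ x : k → ℝ, x i * (x i * smoothNorm δ x) ∂gaussianPi k
      = ∫ x : k → ℝ, 1 * smoothNorm δ x + x i * (x i / smoothNorm δ x) ∂gaussianPi k := fun i =>
    integral_coordinate_mul i (by fun_prop) (cG' i)
      (fun x => by
        simpa using (hasDerivAt_coordinate_line x i).fun_mul (hasDerivAt_smoothNorm_line hδ x i))
      ((growth_coordinate i).mul gN) (gG' i)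
  have he : ∀ x : k → ℝ, (x ⬝ᵥ x) * smoothNorm δ x = ∑ i, x i * (x i * smoothNorm δ x) :=
    fun x => by simp only [dotProduct, Finset.sum_mul, mul_assoc]
  simp only [he]
  refine ⟨integrable_finsetSum _ fun i _ => iG i, ?_⟩
  rw [integral_finsetSum _ fun i _ => iG i, Finset.sum_congr rfl fun i _ => hst i,
    ← integral_finsetSum _ fun i _ => (gG' i).integrable (cG' i), ← integral_const_mul]
  refine integral_mono (integrable_finsetSum _ fun i _ => (gG' i).integrable (cG' i))
    (iN.const_mul _) fun x => ?_
  have h1 : ∑ i, x i * (x i / smoothNorm δ x) = (x ⬝ᵥ x) / smoothNorm δ x := by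
    simp only [dotProduct, Finset.sum_div, mul_div_assoc]
  have h2 : (x ⬝ᵥ x) / smoothNorm δ x ≤ smoothNorm δ x := by
    rw [div_le_iff₀ (hN x), ← sq, smoothNorm_sq]
    linarith [sq_nonneg δ]
  simp only [Finset.sum_add_distrib, h1, one_mul, Finset.sum_const, Finset.card_univ, nsmul_eq_mul]
  linarith

/-- The lower bound `m / √(m + 1)` for the expected norm of a standard Gaussian vector. -/
theorem card_div_sqrt_le_integral_smoothNorm {δ : ℝ} (hδ : 0 < δ) :
    (Fintype.card k : ℝ) / Real.sqrt (Fintype.card k + 1)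
      ≤ ∫ x : k → ℝ, smoothNorm δ x ∂gaussianPi k := by
  obtain ⟨i1, h1⟩ := integral_dotProduct_self_mul_smoothNorm_le (k := k) hδ
  have iN : Integrable (smoothNorm (k := k) δ) (gaussianPi k) :=
    (growth_smoothNorm hδ).integrable (contDiff_smoothNorm hδ).continuous
  have hs2 : Real.sqrt ((Fintype.card k : ℝ) + 1) ^ 2 = Fintype.card k + 1 :=
    Real.sq_sqrt (by positivity)
  have hs : 0 < Real.sqrt ((Fintype.card k : ℝ) + 1) := Real.sqrt_pos.2 (by positivity)
  set s := Real.sqrt ((Fintype.card k : ℝ) + 1)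
  -- This is `2 s r ≤ s² + r²` multiplied by `r = ‖x‖`. After integration both terms on the right
  -- are bounded by `s² 𝔼N` precisely because `s² = card k + 1`, which leaves `card k ≤ s 𝔼N`.
  have hpt : ∀ x : k → ℝ,
      2 * s * (x ⬝ᵥ x) ≤ s ^ 2 * smoothNorm δ x + (x ⬝ᵥ x) * smoothNorm δ x := fun x => by
    have h2 := Real.sq_sqrt (dotProduct_self_nonneg_real x)
    have h3 : Real.sqrt (x ⬝ᵥ x) ≤ smoothNorm δ x :=
      Real.sqrt_le_sqrt (by linarith [sq_nonneg δ])
    have h4 := Real.sqrt_nonneg (x ⬝ᵥ x)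
    set r := Real.sqrt (x ⬝ᵥ x)
    rw [← h2]
    calc 2 * s * r ^ 2 = (2 * s * r) * r := by ring
      _ ≤ (s ^ 2 + r ^ 2) * r :=
          mul_le_mul_of_nonneg_right (by nlinarith [sq_nonneg (s - r)]) h4
      _ ≤ (s ^ 2 + r ^ 2) * smoothNorm δ x := mul_le_mul_of_nonneg_left h3 (by positivity)
      _ = _ := by ring
  have h5 := integral_mono (integrable_dotProduct_self.const_mul (2 * s))
    ((iN.const_mul (s ^ 2)).add i1) hpt
  rw [integral_const_mul, integral_dotProduct_self, integral_add' (iN.const_mul (s ^ 2)) i1,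
    integral_const_mul] at h5
  rw [div_le_iff₀ hs]
  have h6 : 2 * s * (Fintype.card k : ℝ)
      ≤ 2 * s * ((∫ x : k → ℝ, smoothNorm δ x ∂gaussianPi k) * s) := by
    calc _ ≤ _ := h5
      _ ≤ s ^ 2 * (∫ x : k → ℝ, smoothNorm δ x ∂gaussianPi k) +
          s ^ 2 * ∫ x : k → ℝ, smoothNorm δ x ∂gaussianPi k := by rw [hs2]; linarith
      _ = _ := by ring
  exact le_of_mul_le_mul_left h6 (by positivity)

end Moments

/-! ### The ℓ₁ objective: subgradients, slope and mean width of the descent cone. -/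

section L1

variable {ι κ : Type*} [Fintype ι] [Fintype κ]

theorem l1Norm_nonneg (v : ι → ℝ) : 0 ≤ l1Norm v := norm_nonneg _

theorem dotProduct_le_l1Norm {a v : ι → ℝ} (ha : ∀ i, |a i| ≤ 1) : a ⬝ᵥ v ≤ l1Norm v := by
  rw [l1Norm_eq_sum]
  refine Finset.sum_le_sum fun i _ => (le_abs_self _).trans ?_
  rw [abs_mul]
  exact mul_le_of_le_one_left (abs_nonneg _) (ha i)

theorem l1Norm_smul (c : ℝ) (v : ι → ℝ) : l1Norm (c • v) = |c| * l1Norm v := by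
  simp [l1Norm_eq_sum, abs_mul, Finset.mul_sum]

theorem dotProduct_self_eq_norm_sq (v : ι → ℝ) : v ⬝ᵥ v = ‖WithLp.toLp 2 v‖ ^ 2 := by
  rw [EuclideanSpace.real_norm_sq_eq]
  simp [dotProduct, sq]

end L1

section Operator

variable {p d : ℕ} (Ω : Matrix (Fin p) (Fin d) ℝ)

theorem l1Norm_mulVec_sq_le (v : Fin d → ℝ) : l1Norm (Ω *ᵥ v) ^ 2 ≤ maxL1Sq Ω * (v ⬝ᵥ v) := by
  rcases eq_or_ne v 0 with rfl | hv
  · simp [l1Norm_eq_sum]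
  have hn : 0 < ‖WithLp.toLp 2 v‖ := norm_pos_iff.2 (by simpa using hv)
  have h := (isGreatest_maxL1Sq Ω).2 ⟨‖WithLp.toLp 2 v‖⁻¹ • WithLp.toLp 2 v, by
    simp [norm_smul, hn.ne'], rfl⟩
  simp only [WithLp.ofLp_smul, mulVec_smul, l1Norm_smul] at h
  rw [mul_pow, sq_abs, inv_pow, inv_mul_le_iff₀ (by positivity)] at h
  rw [dotProduct_self_eq_norm_sq, mul_comm]
  exact h

theorem maxL1Sq_nonneg : 0 ≤ maxL1Sq Ω := by
  obtain ⟨z, _, hz⟩ := (isGreatest_maxL1Sq Ω).1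
  rw [← hz]
  exact sq_nonneg _

variable {Ω} in
theorem maxL1Sq_pos (hΩ : Ω ≠ 0) : 0 < maxL1Sq Ω := by
  refine (maxL1Sq_nonneg Ω).lt_of_ne fun h0 => hΩ ?_
  ext i j
  have h := l1Norm_mulVec_sq_le Ω (Pi.single j 1)
  rw [← h0, zero_mul, sq_nonpos_iff, l1Norm_eq_sum,
    Finset.sum_eq_zero_iff_of_nonneg fun _ _ => abs_nonneg _] at h
  simpa using h i (Finset.mem_univ i)

/-- Duality: with `u = Ωᵀ a`, `‖u‖² = ⟨a, Ω u⟩ ≤ ‖Ω u‖₁ ≤ √(maxL1Sq Ω) ‖u‖`. It bounds the length of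
every subgradient used below. -/
theorem dotProduct_transpose_mulVec_self_le {a : Fin p → ℝ} (ha : ∀ i, |a i| ≤ 1) :
    (Ωᵀ *ᵥ a) ⬝ᵥ (Ωᵀ *ᵥ a) ≤ maxL1Sq Ω := by
  set u := Ωᵀ *ᵥ a with hu
  have h0 := dotProduct_self_nonneg_real u
  have h1 : u ⬝ᵥ u ≤ l1Norm (Ω *ᵥ u) := by
    have : u ⬝ᵥ u = a ⬝ᵥ (Ω *ᵥ u) := by
      rw [dotProduct_comm a, ← transpose_transpose Ω, mulVec_transpose, ← dotProduct_mulVec]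
    rw [this]
    exact dotProduct_le_l1Norm ha
  have h2 := l1Norm_mulVec_sq_le Ω u
  by_contra hlt
  push Not at hlt
  have h3 := maxL1Sq_nonneg Ω
  nlinarith [mul_self_le_mul_self h0 h1]

/-- The sign vector of `Ω x`. -/
noncomputable def signVector (x : EuclideanSpace ℝ (Fin d)) (i : Fin p) : ℝ :=
  SignType.sign ((Ω *ᵥ x.ofLp) i)

/-- The directional derivative of `z ↦ ‖Ω z‖₁` at `x` in the direction `v`. -/
noncomputable def l1Slope (x : EuclideanSpace ℝ (Fin d)) (v : Fin d → ℝ) : ℝ :=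
  l1Norm (rowSubmatrix Ω (cosupport Ω x) *ᵥ v) + (Ωᵀ *ᵥ signVector Ω x) ⬝ᵥ v

/-- A subgradient of `z ↦ ‖Ω z‖₁` at `x` that computes the slope in the direction `v`. -/
noncomputable def subgradientCoeff (x : EuclideanSpace ℝ (Fin d)) (v : Fin d → ℝ) (i : Fin p) : ℝ :=
  if i ∈ cosupport Ω x then (SignType.sign ((Ω *ᵥ v) i) : ℝ) else signVector Ω x i

theorem abs_sign_le_one (r : ℝ) : |((SignType.sign r : SignType) : ℝ)| ≤ 1 := by
  rcases lt_trichotomy r 0 with h | h | h <;> simp [h]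

theorem abs_subgradientCoeff_le (x : EuclideanSpace ℝ (Fin d)) (v : Fin d → ℝ) (i : Fin p) :
    |subgradientCoeff Ω x v i| ≤ 1 := by
  rw [subgradientCoeff]
  split_ifs <;> exact abs_sign_le_one _

theorem signVector_eq_zero {x : EuclideanSpace ℝ (Fin d)} {i : Fin p} (hi : i ∈ cosupport Ω x) :
    signVector Ω x i = 0 := by
  simp only [cosupport, Finset.mem_filter, Finset.mem_univ, true_and] at hi
  simp [signVector, hi]

theorem l1Slope_eq_sum (x : EuclideanSpace ℝ (Fin d)) (v : Fin d → ℝ) :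
    l1Slope Ω x v = ∑ i, if i ∈ cosupport Ω x then |(Ω *ᵥ v) i|
      else signVector Ω x i * (Ω *ᵥ v) i := by
  have h1 : l1Norm (rowSubmatrix Ω (cosupport Ω x) *ᵥ v)
      = ∑ i ∈ cosupport Ω x, |(Ω *ᵥ v) i| := by
    rw [l1Norm_eq_sum, ← Finset.sum_coe_sort (cosupport Ω x) fun i => |(Ω *ᵥ v) i|]
    rfl
  have h2 : (Ωᵀ *ᵥ signVector Ω x) ⬝ᵥ v = ∑ i, signVector Ω x i * (Ω *ᵥ v) i := by
    rw [mulVec_transpose, ← dotProduct_mulVec]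
    rfl
  rw [l1Slope, h1, h2, ← Finset.sum_filter_add_sum_filter_not Finset.univ
    (fun i => i ∈ cosupport Ω x), ← Finset.sum_filter_add_sum_filter_not Finset.univ
    (fun i => i ∈ cosupport Ω x) fun i => ite _ _ _, Finset.filter_univ_mem]
  have h3 : ∑ i ∈ cosupport Ω x, signVector Ω x i * (Ω *ᵥ v) i = 0 :=
    Finset.sum_eq_zero fun i hi => by rw [signVector_eq_zero Ω hi, zero_mul]
  rw [h3, zero_add]
  congr 1
  · exact Finset.sum_congr rfl fun i hi => (if_pos hi).symm
  · exact Finset.sum_congr rfl fun i hi => (if_neg (Finset.mem_filter.1 hi).2).symm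

theorem subgradient_dotProduct_self (x : EuclideanSpace ℝ (Fin d)) (v : Fin d → ℝ) :
    (Ωᵀ *ᵥ subgradientCoeff Ω x v) ⬝ᵥ v = l1Slope Ω x v := by
  rw [mulVec_transpose, ← dotProduct_mulVec, l1Slope_eq_sum]
  refine Finset.sum_congr rfl fun i _ => ?_
  rw [subgradientCoeff]
  split_ifs
  · exact sign_mul_self _
  · rfl

theorem subgradient_dotProduct_le (x : EuclideanSpace ℝ (Fin d)) (v w : Fin d → ℝ) :
    (Ωᵀ *ᵥ subgradientCoeff Ω x v) ⬝ᵥ w ≤ l1Slope Ω x w := by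
  rw [mulVec_transpose, ← dotProduct_mulVec, l1Slope_eq_sum]
  refine Finset.sum_le_sum fun i _ => ?_
  have h := abs_subgradientCoeff_le Ω x v i
  split_ifs with hi
  · refine (le_abs_self _).trans ?_
    rw [abs_mul]
    exact mul_le_of_le_one_left (abs_nonneg _) h
  · rw [subgradientCoeff, if_neg hi]

theorem l1Slope_smul_of_nonneg (x : EuclideanSpace ℝ (Fin d)) {c : ℝ} (hc : 0 ≤ c)
    (v : Fin d → ℝ) : l1Slope Ω x (c • v) = c * l1Slope Ω x v := by
  simp only [l1Slope, mulVec_smul, l1Norm_smul, abs_of_nonneg hc, dotProduct_smul, smul_eq_mul]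
  ring

/-- Convexity, row by row: on the cosupport both sides agree, and elsewhere `sign(a) b ≤ |b|`. A
point with no larger objective than `x` therefore lies in a direction of nonpositive slope. -/
theorem l1Slope_sub_le (x z : EuclideanSpace ℝ (Fin d)) :
    l1Slope Ω x (z.ofLp - x.ofLp) ≤ l1Norm (Ω *ᵥ z.ofLp) - l1Norm (Ω *ᵥ x.ofLp) := by
  rw [l1Slope_eq_sum, l1Norm_eq_sum, l1Norm_eq_sum, ← Finset.sum_sub_distrib]
  refine Finset.sum_le_sum fun i _ => ?_
  rw [mulVec_sub, Pi.sub_apply]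
  split_ifs with hi
  · simp only [cosupport, Finset.mem_filter, Finset.mem_univ, true_and] at hi
    simp [hi]
  · rw [mul_sub, signVector, sign_mul_self]
    refine sub_le_sub_right ((le_abs_self _).trans ?_) _
    rw [abs_mul]
    exact mul_le_of_le_one_left (abs_nonneg _) (abs_sign_le_one _)

/-- An upper bound for the squared distance of `h` from `t` times the subdifferential. -/
noncomputable def subdiffDistSq (x : EuclideanSpace ℝ (Fin d)) (t : ℝ) (h : Fin d → ℝ) : ℝ :=
  h ⬝ᵥ h - 2 * t * l1Slope Ω x h + t ^ 2 * maxL1Sq Ω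

/-- Take the subgradient `u` that attains the slope at `h`. Since `⟨u, z⟩ ≤ 0`, one has `⟨z, h⟩ ≤
⟨z, h - t u⟩`; expanding `‖s z - (h - t u)‖² ≥ 0` and using `‖u‖² ≤ maxL1Sq Ω` finishes. The
quadratic form in `s` avoids the mean of a square root. -/
theorem two_mul_dotProduct_le (x : EuclideanSpace ℝ (Fin d)) {t : ℝ} (ht : 0 ≤ t) (s : ℝ)
    {z : Fin d → ℝ} (hz : z ⬝ᵥ z = 1) {h : Fin d → ℝ} (hs : 0 ≤ s) (hzx : l1Slope Ω x z ≤ 0) :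
    2 * s * (z ⬝ᵥ h) ≤ s ^ 2 + subdiffDistSq Ω x t h := by
  set u := Ωᵀ *ᵥ subgradientCoeff Ω x h with hu
  have h1 : u ⬝ᵥ h = l1Slope Ω x h := subgradient_dotProduct_self Ω x h
  have h2 : u ⬝ᵥ z ≤ 0 := (subgradient_dotProduct_le Ω x h z).trans hzx
  have h3 : u ⬝ᵥ u ≤ maxL1Sq Ω :=
    dotProduct_transpose_mulVec_self_le Ω (abs_subgradientCoeff_le Ω x h)
  have h4 := dotProduct_self_nonneg_real (s • z - (h - t • u))
  simp only [sub_dotProduct, dotProduct_sub, smul_dotProduct, dotProduct_smul, smul_eq_mul, hz,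
    dotProduct_comm z u, dotProduct_comm h u, dotProduct_comm h z, h1] at h4
  rw [subdiffDistSq]
  nlinarith [mul_le_mul_of_nonneg_left h3 (sq_nonneg t), mul_nonneg (mul_nonneg hs ht) (neg_nonneg.2 h2)]

theorem expectedL1_eq {ι : Type*} [Fintype ι] (A : Matrix ι (Fin d) ℝ) :
    expectedL1 A = ∫ h, l1Norm (A *ᵥ h) ∂gaussianPi (Fin d) := by
  rw [expectedL1, ← map_pi_eq_stdGaussian, integral_map (by fun_prop)]
  refine Continuous.aestronglyMeasurable ?_
  simp only [l1Norm_eq_sum, mulVec, dotProduct]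
  fun_prop

theorem integrable_l1Norm_mulVec_gaussianPi {ι : Type*} [Fintype ι] (A : Matrix ι (Fin d) ℝ) :
    Integrable (fun h => l1Norm (A *ᵥ h)) (gaussianPi (Fin d)) := by
  simp only [l1Norm_eq_sum]
  exact integrable_finsetSum _ fun i _ => (integrable_dotProduct (A i)).abs

theorem integral_subdiffDistSq (x : EuclideanSpace ℝ (Fin d)) (t : ℝ) :
    Integrable (subdiffDistSq Ω x t) (gaussianPi (Fin d)) ∧
    ∫ h, subdiffDistSq Ω x t h ∂gaussianPi (Fin d)
      = d - 2 * t * expectedL1 (rowSubmatrix Ω (cosupport Ω x)) + t ^ 2 * maxL1Sq Ω := by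
  have i1 := integrable_l1Norm_mulVec_gaussianPi (rowSubmatrix Ω (cosupport Ω x))
  have i2 := integrable_dotProduct (Ωᵀ *ᵥ signVector Ω x)
  have i3 : Integrable (l1Slope Ω x) (gaussianPi (Fin d)) := i1.add i2
  have i4 := integrable_dotProduct_self (k := Fin d)
  -- The sign part of the slope is linear in `h`, hence centred; only the cosupport rows contribute.
  have e3 : ∫ h, l1Slope Ω x h ∂gaussianPi (Fin d)
      = expectedL1 (rowSubmatrix Ω (cosupport Ω x)) := by
    simp only [l1Slope]
    rw [integral_add i1 i2, integral_dotProduct, add_zero, expectedL1_eq]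
  have i5 : Integrable (fun h => h ⬝ᵥ h - 2 * t * l1Slope Ω x h) (gaussianPi (Fin d)) :=
    i4.sub (i3.const_mul (2 * t))
  refine ⟨i5.add (integrable_const _), ?_⟩
  unfold subdiffDistSq
  rw [integral_add i5 (integrable_const _), integral_sub i4 (i3.const_mul _), integral_const_mul,
    integral_dotProduct_self, e3]
  simp

theorem expectedL1_nonneg {ι : Type*} [Fintype ι] (A : Matrix ι (Fin d) ℝ) : 0 ≤ expectedL1 A :=
  integral_nonneg fun _ => l1Norm_nonneg _

/-- A bound for the Gaussian mean width of finitely many unit vectors in the descent cone. -/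
theorem integral_softmax_le {Z : Type*} [Fintype Z] [Nonempty Z] (hΩ : Ω ≠ 0)
    (x : EuclideanSpace ℝ (Fin d)) {z : Z → Fin d → ℝ} (hz : ∀ i, z i ⬝ᵥ z i = 1)
    (hzx : ∀ i, l1Slope Ω x (z i) ≤ 0) {e α : ℝ} (he : 0 < e) (hα : 0 < α) :
    ∫ h, softmax α z h ∂gaussianPi (Fin d)
      ≤ Real.sqrt (d - expectedL1 (rowSubmatrix Ω (cosupport Ω x)) ^ 2 / maxL1Sq Ω) + e
        + Real.log (Fintype.card Z) / α := by
  have hK := maxL1Sq_pos hΩ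
  set K := maxL1Sq Ω with hKdef
  set E := expectedL1 (rowSubmatrix Ω (cosupport Ω x)) with hE
  have hE0 : 0 ≤ E := expectedL1_nonneg _
  -- `t = E / K` minimizes `d - 2 t E + t² K`, with minimum `d - E² / K`.
  obtain ⟨iQ, eQ⟩ := integral_subdiffDistSq Ω x (E / K)
  have hq : ∫ h, subdiffDistSq Ω x (E / K) h ∂gaussianPi (Fin d) = d - E ^ 2 / K := by
    rw [eQ, ← hE, ← hKdef]
    field_simp
    ring
  set q := (d : ℝ) - E ^ 2 / K with hqdef
  -- The optimal `s` is `√q`; adding `e` keeps it positive for the division by `2 s`.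
  set s := Real.sqrt q + e with hs
  have hsq := Real.sqrt_nonneg q
  have hs0 : 0 < s := by positivity
  -- The sign of `q` is not needed: `Real.sqrt` of a negative number is `0`, and then `q ≤ 0`.
  have hqs : q ≤ Real.sqrt q ^ 2 := by
    rcases le_or_gt 0 q with h | h
    · rw [Real.sq_sqrt h]
    · nlinarith
  have hpt : ∀ h, softmax α z h ≤ (s ^ 2 + subdiffDistSq Ω x (E / K) h) / (2 * s)
      + Real.log (Fintype.card Z) / α := fun h => softmax_le hα fun i => by
    rw [le_div_iff₀ (by positivity), mul_comm]
    exact two_mul_dotProduct_le Ω x (div_nonneg hE0 hK.le) s (hz i) hs0.le (hzx i)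
  have iS := integrable_of_sum_sq_partialDeriv_le (contDiff_softmax (α := α) (p := z))
    (sum_sq_partialDeriv_softmax_le hα hz)
  have i1 : Integrable (fun h => (s ^ 2 + subdiffDistSq Ω x (E / K) h) / (2 * s))
      (gaussianPi (Fin d)) := ((integrable_const _).add iQ).div_const _
  have h1 := integral_mono iS (i1.add (integrable_const _)) hpt
  rw [integral_add' i1 (integrable_const _), integral_div,
    integral_add (integrable_const _) iQ, hq] at h1
  simp only [integral_const, probReal_univ, smul_eq_mul, one_mul] at h1
  refine h1.trans ?_
  gcongr
  rw [div_le_iff₀ (by positivity)]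
  nlinarith

end Operator

/-! ### Lower bound for `M` on the cone, and recovery. -/

section Recovery

variable {p m d : ℕ} (Ω : Matrix (Fin p) (Fin d) ℝ)

/-- The lower tail of `‖M z‖` over finitely many unit vectors in the descent cone. -/
theorem measureReal_exists_norm_lt_le {Z : Type*} [Fintype Z] [Nonempty Z] (hΩ : Ω ≠ 0)
    (x : EuclideanSpace ℝ (Fin d)) {z : Z → Fin d → ℝ} (hz : ∀ i, z i ⬝ᵥ z i = 1)
    (hzx : ∀ i, l1Slope Ω x (z i) ≤ 0) {r τ : ℝ} (hr : 0 < r)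
    (hm : Real.sqrt (d - expectedL1 (rowSubmatrix Ω (cosupport Ω x)) ^ 2 / maxL1Sq Ω) + r + τ
      ≤ m / Real.sqrt (m + 1)) :
    (gaussianPi (Fin m × Fin d)).real {M | ∃ i, Real.sqrt ((fun k => ∑ j, M (k, j) * z i j) ⬝ᵥ
      fun k => ∑ j, M (k, j) * z i j) < τ} ≤ Real.exp (-(r ^ 2 / 2)) := by
  classical
  set P := (gaussianPi (Fin m × Fin d)).real {M | ∃ i, Real.sqrt
    ((fun k => ∑ j, M (k, j) * z i j) ⬝ᵥ fun k => ∑ j, M (k, j) * z i j) < τ} with hP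
  set w := Real.sqrt (d - expectedL1 (rowSubmatrix Ω (cosupport Ω x)) ^ 2 / maxL1Sq Ω) with hw
  -- All smoothing errors are set to `e`. The term `4 r e` collects one from the norm in the tail
  -- event, one from the cutoff width, and two from the softmax mean.
  have key : ∀ e > 0, P ≤ Real.exp (-(r ^ 2 / 2) + 4 * r * e) := by
    intro e he
    have hlog : 0 ≤ Real.log (Fintype.card Z) := Real.log_natCast_nonneg _
    -- The added 1 keeps `α` positive when `Z` has a single point.
    set α := (Real.log (Fintype.card Z) + 1) / e with hα
    have hα0 : 0 < α := by positivity
    have hαe : Real.log (Fintype.card Z) / α ≤ e := by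
      rw [div_le_iff₀ hα0, hα, mul_div_cancel₀ _ he.ne']
      linarith
    have hS := sum_sq_partialDeriv_softmax_le hα0 hz
    have cS := contDiff_softmax (α := α) (p := z)
    obtain ⟨c, hc⟩ := (tameC1_exp_mul cS hS r).growth
    have h1 := gordon_tail_le (I := Fin m) hz he he hr τ cS.continuous
      (fun i h => dotProduct_le_softmax hα0 i h) hc
    have h2 : ∫ g : Fin m → ℝ, Real.exp (-r * smoothNorm e g) ∂gaussianPi (Fin m)
        ≤ Real.exp (-r * (m / Real.sqrt (m + 1)) + r ^ 2 / 2) := by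
      have h3 := integral_exp_mul_le (contDiff_smoothNorm (k := Fin m) he)
        (sum_sq_partialDeriv_smoothNorm_le he) (-r)
      refine h3.trans (Real.exp_le_exp.2 ?_)
      have h4 := card_div_sqrt_le_integral_smoothNorm (k := Fin m) he
      rw [Fintype.card_fin] at h4
      nlinarith
    have h5 : ∫ h : Fin d → ℝ, Real.exp (r * softmax α z h) ∂gaussianPi (Fin d)
        ≤ Real.exp (r * (w + e + e) + r ^ 2 / 2) := by
      refine (integral_exp_mul_le cS hS r).trans (Real.exp_le_exp.2 ?_)
      have h6 := integral_softmax_le Ω hΩ x hz hzx he hα0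
      rw [mul_one]
      gcongr
      linarith
    have h7 := h1.trans (mul_le_mul_of_nonneg_left (mul_le_mul h2 h5
      (integral_nonneg fun _ => (Real.exp_pos _).le) (Real.exp_pos _).le) (Real.exp_pos _).le)
    rw [← hP] at h7
    simp only [← Real.exp_add] at h7
    rw [← le_div_iff₀' (Real.exp_pos _), ← Real.exp_sub] at h7
    refine h7.trans (Real.exp_le_exp.2 ?_)
    -- Before the errors, the exponent is `-r (m/√(m+1) - w - τ) + r²/2`: two variance terms on the
    -- right against one from `γ` on the left. By `hm` it is at most `-r²/2`.
    have h8 := mul_le_mul_of_nonneg_left hm hr.le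
    nlinarith
  have ht : Filter.Tendsto (fun e : ℝ => Real.exp (-(r ^ 2 / 2) + 4 * r * e))
      (nhdsWithin 0 (Set.Ioi 0)) (nhds (Real.exp (-(r ^ 2 / 2) + 4 * r * 0))) :=
    (Continuous.tendsto (by fun_prop) 0).mono_left nhdsWithin_le_nhds
  rw [mul_zero, add_zero] at ht
  exact ge_of_tendsto ht (Filter.eventually_of_mem self_mem_nhdsWithin key)

/-- With probability at least `1 - exp (-r² / 2)`, the matrix `M` is bounded below by `τ` on all
unit vectors in the descent cone. -/
theorem exists_measurableSet_norm_ge (hΩ : Ω ≠ 0) (x : EuclideanSpace ℝ (Fin d)) {r τ : ℝ}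
    (hr : 0 < r)
    (hm : Real.sqrt (d - expectedL1 (rowSubmatrix Ω (cosupport Ω x)) ^ 2 / maxL1Sq Ω) + r + τ
      ≤ m / Real.sqrt (m + 1)) :
    ∃ B : Set (Fin m × Fin d → ℝ), MeasurableSet B ∧
      gaussianPi (Fin m × Fin d) B ≤ ENNReal.ofReal (Real.exp (-(r ^ 2 / 2))) ∧
      ∀ M ∉ B, ∀ z : Fin d → ℝ, z ⬝ᵥ z = 1 → l1Slope Ω x z ≤ 0 →
        τ ≤ Real.sqrt ((fun k => ∑ j, M (k, j) * z j) ⬝ᵥ fun k => ∑ j, M (k, j) * z j) := by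
  set C : Set (Fin d → ℝ) := {z | z ⬝ᵥ z = 1 ∧ l1Slope Ω x z ≤ 0} with hC
  rcases isEmpty_or_nonempty C with hCe | hCn
  · exact ⟨∅, MeasurableSet.empty, by simp, fun M _ z h1 h2 => (hCe.false ⟨z, h1, h2⟩).elim⟩
  -- The finite bound does not depend on the number of points, so it passes to the increasing union
  -- over a dense sequence; continuity of `z ↦ ‖M z‖` extends the lower bound to all of `C`.
  obtain ⟨u, hu⟩ := TopologicalSpace.exists_dense_seq C
  set f : (Fin m × Fin d → ℝ) → (Fin d → ℝ) → ℝ := fun M z =>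
    Real.sqrt ((fun k => ∑ j, M (k, j) * z j) ⬝ᵥ fun k => ∑ j, M (k, j) * z j) with hf
  have cf : ∀ z, Continuous fun M => f M z := fun z => by
    simp only [hf, dotProduct]; fun_prop
  have cf' : ∀ M, Continuous (f M) := fun M => by
    simp only [hf, dotProduct]; fun_prop
  set B : ℕ → Set (Fin m × Fin d → ℝ) := fun n => {M | ∃ i : Fin (n + 1), f M (u i) < τ} with hB
  have mB : ∀ n, MeasurableSet (B n) := fun n => by
    simp only [hB, Set.ofPred_exists]
    exact MeasurableSet.iUnion fun i => measurableSet_lt (cf _).measurable measurable_const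
  have hBm : Monotone B := fun n n' hn M ⟨i, hi⟩ => ⟨⟨i, by omega⟩, hi⟩
  refine ⟨⋃ n, B n, MeasurableSet.iUnion mB, ?_, fun M hM z hz hzx => ?_⟩
  · rw [hBm.measure_iUnion]
    refine iSup_le fun n => ?_
    rw [← ENNReal.ofReal_toReal (measure_ne_top (gaussianPi (Fin m × Fin d)) (B n))]
    exact ENNReal.ofReal_le_ofReal (measureReal_exists_norm_lt_le Ω hΩ x
      (z := fun i : Fin (n + 1) => (u i : Fin d → ℝ)) (fun i => (u i).2.1)
      (fun i => (u i).2.2) hr hm)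
  · have hcl : IsClosed {y : C | τ ≤ f M y} :=
      isClosed_le continuous_const ((cf' M).comp continuous_subtype_val)
    have hall : ∀ n, u n ∈ {y : C | τ ≤ f M y} := fun n => by
      by_contra hlt
      exact hM (Set.mem_iUnion.2 ⟨n, ⟨Fin.last n, not_le.1 hlt⟩⟩)
    have := hcl.closure_subset_iff.2 (Set.range_subset_iff.2 hall) (hu.closure_eq ▸ trivial :
      (⟨z, hz, hzx⟩ : C) ∈ closure (Set.range u))
    exact this

/-- The normalized error is a unit vector of nonpositive slope, so `τ ‖x̂ - x‖ ≤ ‖M (x̂ - x)‖`; the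
triangle inequality through `y` bounds the right side by `2η`. -/
theorem norm_sub_le_of_isAnalysisL1Minimizer {M : Matrix (Fin m) (Fin d) ℝ}
    {x : EuclideanSpace ℝ (Fin d)} {η τ : ℝ} (hτ : 0 < τ)
    (hM : ∀ z : Fin d → ℝ, z ⬝ᵥ z = 1 → l1Slope Ω x z ≤ 0 → τ ≤ ‖WithLp.toLp 2 (M *ᵥ z)‖)
    {w : EuclideanSpace ℝ (Fin m)} (hw : ‖w‖ ≤ η) {xhat : EuclideanSpace ℝ (Fin d)}
    (h : IsAnalysisL1Minimizer Ω M (WithLp.toLp 2 (M *ᵥ x.ofLp) + w) η xhat) :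
    ‖x - xhat‖ ≤ 2 * η / τ := by
  have hη : 0 ≤ η := (norm_nonneg w).trans hw
  rcases eq_or_ne (xhat - x) 0 with h0 | h0
  · rw [← norm_neg, neg_sub, h0, norm_zero]
    positivity
  have hn : 0 < ‖xhat - x‖ := norm_pos_iff.2 h0
  have hx : x ∈ feasibleSet M (WithLp.toLp 2 (M *ᵥ x.ofLp) + w) η := by
    simpa [feasibleSet] using hw
  have hmin : l1Norm (Ω *ᵥ xhat.ofLp) ≤ l1Norm (Ω *ᵥ x.ofLp) := h.2 hx
  have hfeas : ‖WithLp.toLp 2 (M *ᵥ xhat.ofLp) - (WithLp.toLp 2 (M *ᵥ x.ofLp) + w)‖ ≤ η := h.1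
  have hslope : l1Slope Ω x (‖xhat - x‖⁻¹ • (xhat.ofLp - x.ofLp)) ≤ 0 := by
    rw [l1Slope_smul_of_nonneg Ω x (inv_nonneg.2 hn.le)]
    exact mul_nonpos_of_nonneg_of_nonpos (inv_nonneg.2 hn.le)
      ((l1Slope_sub_le Ω x xhat).trans (sub_nonpos.2 hmin))
  have hunit : (‖xhat - x‖⁻¹ • (xhat.ofLp - x.ofLp)) ⬝ᵥ
      (‖xhat - x‖⁻¹ • (xhat.ofLp - x.ofLp)) = 1 := by
    have h1 : WithLp.toLp 2 (xhat.ofLp - x.ofLp) = xhat - x := rfl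
    rw [dotProduct_self_eq_norm_sq, WithLp.toLp_smul, h1, norm_smul, norm_inv, norm_norm, inv_mul_cancel₀ hn.ne', one_pow]
  have h1 := hM _ hunit hslope
  rw [mulVec_smul, WithLp.toLp_smul, norm_smul, norm_inv, norm_norm, mulVec_sub, WithLp.toLp_sub,
    le_inv_mul_iff₀ hn] at h1
  have h2 : ‖WithLp.toLp 2 (M *ᵥ xhat.ofLp) - WithLp.toLp 2 (M *ᵥ x.ofLp)‖ ≤ 2 * η := by
    calc _ = ‖(WithLp.toLp 2 (M *ᵥ xhat.ofLp) - (WithLp.toLp 2 (M *ᵥ x.ofLp) + w)) + w‖ := by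
          congr 1; abel
      _ ≤ η + η := (norm_add_le _ _).trans (add_le_add hfeas hw)
      _ = 2 * η := by ring
  rw [norm_sub_rev, le_div_iff₀ hτ]
  linarith

end Recovery

theorem mainTheorem1 {p m d : ℕ} (Ω : Matrix (Fin p) (Fin d) ℝ) (hΩ : Ω ≠ 0)
    (x : EuclideanSpace ℝ (Fin d)) (Λ : Finset (Fin p)) (hΛ : Λ = cosupport Ω x)
    {S : Type*} [MeasurableSpace S] (P : Measure S) [IsProbabilityMeasure P]
    (M : S → Matrix (Fin m) (Fin d) ℝ) (hM : IsGaussianMatrix P M)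
    (η ε τ : ℝ) (hε₀ : 0 < ε) (hε₁ : ε < 1) (hτ : 0 < τ)
    (hm : (m : ℝ) ^ 2 / ((m : ℝ) + 1) ≥
      (Real.sqrt ((d : ℝ) - (expectedL1 (rowSubmatrix Ω Λ)) ^ 2 / maxL1Sq Ω)
        + Real.sqrt (2 * Real.log ε⁻¹) + τ) ^ 2) :
    ∃ A : Set S, MeasurableSet A ∧ P A ≥ ENNReal.ofReal (1 - ε) ∧
      ∀ s ∈ A, ∀ w : EuclideanSpace ℝ (Fin m), ‖w‖ ≤ η →
        ∀ xhat : EuclideanSpace ℝ (Fin d),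
          IsAnalysisL1Minimizer Ω (M s) (WithLp.toLp 2 (M s *ᵥ x.ofLp) + w) η xhat →
            ‖x - xhat‖ ≤ 2 * η / τ := by
  subst hΛ
  have hlog : 0 < Real.log ε⁻¹ := Real.log_pos ((one_lt_inv₀ hε₀).2 hε₁)
  have hr : 0 < Real.sqrt (2 * Real.log ε⁻¹) := Real.sqrt_pos.2 (by positivity)
  have hexp : Real.exp (-(Real.sqrt (2 * Real.log ε⁻¹) ^ 2 / 2)) = ε := by
    rw [Real.sq_sqrt (by positivity), mul_div_cancel_left₀ _ two_ne_zero, Real.log_inv, neg_neg,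
      Real.exp_log hε₀]
  have hm' : Real.sqrt (d - expectedL1 (rowSubmatrix Ω (cosupport Ω x)) ^ 2 / maxL1Sq Ω)
      + Real.sqrt (2 * Real.log ε⁻¹) + τ ≤ m / Real.sqrt (m + 1) := by
    refine (le_abs_self _).trans (abs_le_of_sq_le_sq ?_ (by positivity))
    rw [div_pow, Real.sq_sqrt (by positivity)]
    exact hm
  obtain ⟨B, mB, hPB, hB⟩ := exists_measurableSet_norm_ge Ω hΩ x hr hm'
  rw [hexp] at hPB
  have hlaw : HasLaw (fun s (ij : Fin m × Fin d) => M s ij.1 ij.2)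
      (gaussianPi (Fin m × Fin d)) P :=
    iIndepFun.hasLaw_pi (fun ij => hM.hasLaw_entry ij.1 ij.2) hM.indep
  -- `HasLaw` gives only almost-everywhere measurability, so the preimage of the good set is
  -- null-measurable; a measurable subset with the same probability is taken as the event.
  obtain ⟨A, hAsub, mA, hAe⟩ :=
    (hlaw.aemeasurable.nullMeasurableSet_preimage mB.compl).exists_measurable_subset_ae_eq
  refine ⟨A, mA, ?_, fun s hs w hw xhat h => ?_⟩
  · rw [measure_congr hAe, ← Measure.map_apply_of_aemeasurable hlaw.aemeasurable mB.compl,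
      hlaw.map_eq, prob_compl_eq_one_sub mB, ENNReal.ofReal_sub _ hε₀.le, ENNReal.ofReal_one]
    exact tsub_le_tsub_left hPB 1
  · refine norm_sub_le_of_isAnalysisL1Minimizer Ω hτ (fun z hz hzx => ?_) hw h
    have h1 := hB _ (hAsub hs) z hz hzx
    refine h1.trans_eq ?_
    rw [← Real.sqrt_sq (norm_nonneg _), ← dotProduct_self_eq_norm_sq]
    rfl
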